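/- Let $D=\{(x,y)\in\mathbb C^2:\operatorname{Im}(x\bar y)>0\}$ and $G=\mathbb C^*\cdot \mathrm{SL}(2,\mathbb R)\subset \mathrm{GL}(2,\mathbb C)$, acting linearly on $D$. Let $\Gamma\subset G$ be a discrete subgroup acting freely and properly on $D$ with compact quotient $X=D/\Gamma$. (By Belgun, every minimal properly elliptic surface with odd first Betti number is of this form.) Endow $X$ with Belgun's Vaisman metric, i.e. with the lcK form $\omega$ induced by the $\Gamma$-invariant form $\tfrac12\operatorname{Im}(x\bar y)\,dd^c\big(\operatorname{Im}(x\bar y)^{-1}\big)$ on $D$, where $dd^c=\sqrt{-1}\,\partial\bar\partial$; its Kähler covering is $(D,\tilde\omega)$ with $\tilde\omega=\tfrac{\sqrt{-1}}2\partial\bar\partial\big(\operatorname{Im}(x\bar y)^{-1}\big)$. For $N\in\mathbb N\cup\{\infty\}$ and $\lambda\in\mathbb C\setminus\{0\}$ with $|\lambda|\ne1$, let $H^N_\lambda=(\mathbb C^N\setminus\{0\})/\langle\lambda\cdot\mathrm{id}\rangle$ be the classical Hopf manifold (with $\mathbb C^\infty:=\ell^2(\mathbb C)$), with the lcK form $\omega_H$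 induced by $\|z\|^{-2}\omega_0$, where $\omega_0=\tfrac{\sqrt{-1}}2\sum_j dz_j\wedge d\bar z_j$ is the flat Kähler form. Then: 1. For all $N\in\mathbb N\cup\{\infty\}$ and all $\lambda$, there is no lcK immersion of $(X,\omega)$ into $H^N_\lambda$, that is, no holomorphic map $f\colon X\to H^N_\lambda$ with $f^*\omega_H=\omega$. (In particular there is no lcK embedding.) 2. Let $\psi\colon D\to \ell^2(\mathbb C)$ be any Kähler immersion, that is, a holomorphic map with $\psi^*\omega_0=\tilde\omega$. Then $\psi$ is not equivariant under $\Gamma$ with respect to any action by scalars on $\ell^2(\mathbb C)$: there is no function $\chi\colon\Gamma\to\mathbb C$ with $\psi(\gamma z)=\chi(\gamma)\,\psi(z)$ for all $\gamma\in\Gamma$ and $z\in D$. Moreover $\psi$ is not invariant under any non-trivial scalar element of $\Gamma$: if $\gamma=c\cdot\mathrm{Id}\in\Gamma$ with $c\neq1$, then $\psi(\gamma z)\neq\psi(z)$ for some $z\in D$. -/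

import Mathlib

open scoped Manifold ContDiff Topology ComplexConjugate
open TopologicalSpace

set_option linter.unusedSectionVars false

noncomputable section

namespace LcK

/-! ### Real bilinear forms on complex manifolds, pull-back, the operator `dd^c` -/

section Forms

variable {E : Type*} [NormedAddCommGroup E] [NormedSpace ℂ E]
  {E' : Type*} [NormedAddCommGroup E'] [NormedSpace ℂ E']

/-- A field of real bilinear forms on the tangent spaces of a complex manifold `M` modelled
on `E` (all the fields used below are real two-forms). In Mathlib the tangent space of `M` at `x`
is the vector space `E`, viewed through the preferred chart at `x`. -/
abbrev FormField (E : Type*) [NormedAddCommGroup E] [NormedSpace ℂ E] (M : Type*) :=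
  M → LinearMap.BilinForm ℝ E

variable {M : Type*} [TopologicalSpace M] [ChartedSpace E M]
  {M' : Type*} [TopologicalSpace M'] [ChartedSpace E' M']

/-- The differential `T_x M → T_{f x} M'` of a holomorphic map `f`. -/
def differential (f : M → M') (x : M) : E →L[ℂ] E' :=
  mfderiv 𝓘(ℂ, E) 𝓘(ℂ, E') f x

/-- The pull-back of a bilinear form along a complex linear map. -/
def pullForm (L : E →L[ℂ] E') (B : LinearMap.BilinForm ℝ E') : LinearMap.BilinForm ℝ E :=
  B.compl₁₂ ((L : E →ₗ[ℂ] E').restrictScalars ℝ) ((L : E →ₗ[ℂ] E').restrictScalars ℝ)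

/-- The pull-back `f^* η` of a form along a holomorphic map. -/
def pullback (f : M → M') (η : FormField E' M') : FormField E M := fun x =>
  pullForm (differential f x) (η (f x))

/-- `f` is holomorphic (complex analytic) and satisfies `f^* η' = η`. -/
structure IsHolomorphicIsometry (η : FormField E M) (η' : FormField E' M') (f : M → M') :
    Prop where
  holomorphic : ContMDiff 𝓘(ℂ, E) 𝓘(ℂ, E') (ω : WithTop ℕ∞) f
  pullback_eq : pullback f η' = η

end Forms

section Ddc

variable {E : Type*} [NormedAddCommGroup E] [NormedSpace ℂ E]

/-- Multiplication by `√-1`, as a real linear map. -/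
def cplx (E : Type*) [NormedAddCommGroup E] [NormedSpace ℂ E] : E →L[ℝ] E :=
  (Complex.I • ContinuousLinearMap.id ℂ E).restrictScalars ℝ

/-- The real one-form `d^c u = (√-1/2) (∂̄ - ∂) u`, that is `v ↦ - du (√-1 v) / 2`. -/
def dc (u : E → ℝ) (x : E) : E →L[ℝ] ℝ := (-(1 / 2) : ℝ) • (fderiv ℝ u x).comp (cplx E)

/-- The real two-form `dd^c u = √-1 ∂∂̄ u`: the exterior derivative
`(v, w) ↦ D_v (d^c u) (w) - D_w (d^c u) (v)` of the one-form `d^c u`. -/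
def ddc (u : E → ℝ) : FormField E E := fun x =>
  LinearMap.mk₂ ℝ (fun v w => fderiv ℝ (dc u) x v w - fderiv ℝ (dc u) x w v)
    (by intros; simp; ring) (by intros; simp; ring) (by intros; simp; ring)
    (by intros; simp; ring)

/-- `dd^c` commutes with pull-back along linear isomorphisms. -/
lemma pullForm_ddc (u : E → ℝ) (L : E ≃L[ℂ] E) (x : E) :
    pullForm (L : E →L[ℂ] E) (ddc u (L x)) = ddc (fun z => u (L z)) x := by
  let R : E ≃L[ℝ] E := L.restrictScalars ℝ
  let P : (E →L[ℝ] ℝ) ≃L[ℝ] (E →L[ℝ] ℝ) := R.symm.arrowCongr (ContinuousLinearEquiv.refl ℝ ℝ)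
  have hR : ∀ v, R v = L v := fun _ => rfl
  have hP : ∀ f v, P f v = f (L v) := fun _ _ => rfl
  have h1 : dc (fun z => u (L z)) = fun z => P (dc u (R z)) := by
    funext z
    ext v
    have : fderiv ℝ (fun z => u (L z)) z = (fderiv ℝ u (R z)).comp (R : E →L[ℝ] E) :=
      R.comp_right_fderiv (f := u) (x := z)
    simp [dc, this, hP, hR, cplx]
  have h2 : ∀ v w, fderiv ℝ (dc (fun z => u (L z))) x v w = fderiv ℝ (dc u) (L x) (L v) (L w) := by
    intro v w
    have h3 : fderiv ℝ (fun z => P (dc u (R z))) x =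
        (P : (E →L[ℝ] ℝ) →L[ℝ] (E →L[ℝ] ℝ)).comp (fderiv ℝ (fun z => dc u (R z)) x) :=
      P.comp_fderiv (f := fun z => dc u (R z)) (x := x)
    have h4 : fderiv ℝ (fun z => dc u (R z)) x = (fderiv ℝ (dc u) (R x)).comp (R : E →L[ℝ] E) :=
      R.comp_right_fderiv (f := dc u) (x := x)
    rw [h1, h3, h4]
    simp [hP, hR]
  refine LinearMap.ext fun v => LinearMap.ext fun w => ?_
  simp [pullForm, ddc, h2]

lemma ddc_const_mul (u : E → ℝ) (a : ℝ) (x : E) : ddc (fun z => a * u z) x = a • ddc u x := by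
  have h1 : dc (fun z => a * u z) = a • dc u := by
    funext z
    have : fderiv ℝ (fun z => a * u z) z = a • fderiv ℝ u z :=
      congrFun (fderiv_const_smul_field (f := u) a) z
    ext v
    simp [dc, this]
    ring
  have h2 : fderiv ℝ (dc (fun z => a * u z)) x = a • fderiv ℝ (dc u) x := by
    rw [h1]; exact congrFun (fderiv_const_smul_field (f := dc u) a) x
  refine LinearMap.ext fun v => LinearMap.ext fun w => ?_
  simp [ddc, h2]
  ring

end Ddc

/-- The flat Kähler form `ω₀ = (√-1/2) ∑ dz_j ∧ dz̄_j = (1/2) dd^c ‖z‖²` of a complex Hilbert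
space, that is `ω₀ (v, w) = Re ⟨√-1 v, w⟩`, which is `Im ⟨v, w⟩` for an inner product that is
conjugate linear in the first variable. -/
def flatForm (E : Type*) [NormedAddCommGroup E] [InnerProductSpace ℂ E] : FormField E E :=
  fun _ => LinearMap.mk₂ ℝ (fun v w => (inner ℂ v w).im)
    (by intros; simp)
    (by intro c v w; simp [← Complex.coe_smul, mul_comm])
    (by intros; simp)
    (by intro c v w; simp [← Complex.coe_smul, mul_comm])

/-! ### Quotients of open sets by free, properly discontinuous linear actions -/

section Quotients

variable {E : Type*} [NormedAddCommGroup E] [NormedSpace ℂ E]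

/-- The group `Γ` acts on the open set `Ω` by restrictions of complex linear maps, and each point
of `Ω` has a neighbourhood that is disjoint from its translates. -/
class LinearCoveringAction (Γ : Type*) [Group Γ] (Ω : Opens E) [MulAction Γ Ω] : Prop where
  exists_linear : ∀ g : Γ, ∃ L : E →L[ℂ] E, ∀ x : Ω, ((g • x : Ω) : E) = L x
  wandering : ∀ x : Ω, ∃ U ∈ 𝓝 x, ∀ g : Γ, ((g • ·) '' U ∩ U).Nonempty → g = 1

/-- The orbit space `Ω / Γ`. -/
abbrev OrbitSpace (Γ : Type*) [Group Γ] (Ω : Opens E) [MulAction Γ Ω] : Type _ :=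
  Quotient (MulAction.orbitRel Γ Ω)

variable {Γ : Type*} [Group Γ] {Ω : Opens E} [MulAction Γ Ω]

/-- The projection `Ω → Ω / Γ`. -/
def proj (Γ : Type*) [Group Γ] (Ω : Opens E) [MulAction Γ Ω] (x : Ω) : OrbitSpace Γ Ω :=
  Quotient.mk _ x

lemma proj_out (p : OrbitSpace Γ Ω) : proj Γ Ω p.out = p := Quotient.out_eq p

lemma proj_eq_iff {x y : Ω} : proj Γ Ω x = proj Γ Ω y ↔ ∃ g : Γ, g • y = x := Quotient.eq''

variable (Γ Ω) [LinearCoveringAction Γ Ω]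

lemma isQuotientCoveringMap_proj : IsQuotientCoveringMap (proj Γ Ω) Γ where
  __ : Topology.IsQuotientMap (proj Γ Ω) := isQuotientMap_quotient_mk'
  continuous_const_smul g := by
    obtain ⟨L, hL⟩ := LinearCoveringAction.exists_linear (Ω := Ω) g
    refine continuous_induced_rng.2 ?_
    have : ((↑) ∘ fun x : Ω => g • x) = fun x : Ω => L (x : E) := funext hL
    rw [this]
    exact L.continuous.comp continuous_subtype_val
  apply_eq_iff_mem_orbit := Quotient.eq''
  disjoint := LinearCoveringAction.wandering

lemma isLocalHomeomorph_proj : IsLocalHomeomorph (proj Γ Ω) :=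
  (isQuotientCoveringMap_proj Γ Ω).isCoveringMap.isLocalHomeomorph

variable {Γ Ω}

/-- A local homeomorphism which is a restriction of the projection, defined near the chosen
representative of `p`. -/
def sheet (p : OrbitSpace Γ Ω) : OpenPartialHomeomorph Ω (OrbitSpace Γ Ω) :=
  (isLocalHomeomorph_proj Γ Ω p.out).choose

lemma out_mem_sheet (p : OrbitSpace Γ Ω) : p.out ∈ (sheet p).source :=
  (isLocalHomeomorph_proj Γ Ω p.out).choose_spec.1

lemma coe_sheet (p : OrbitSpace Γ Ω) : ⇑(sheet p) = proj Γ Ω :=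
  (isLocalHomeomorph_proj Γ Ω p.out).choose_spec.2.symm

/-- The chart of `Ω / Γ` at `p`: a local section of the projection through the chosen
representative of `p`, followed by the inclusion of `Ω` in `E`. -/
def quotChart (p : OrbitSpace Γ Ω) : OpenPartialHomeomorph (OrbitSpace Γ Ω) E :=
  (sheet p).symm.trans (Ω.openPartialHomeomorphSubtypeCoe ⟨p.out⟩)

instance : ChartedSpace E (OrbitSpace Γ Ω) where
  atlas := Set.range quotChart
  chartAt := quotChart
  mem_chart_source p := by
    have h := (sheet p).map_source (out_mem_sheet p)
    rw [coe_sheet, proj_out] at h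
    simpa [quotChart] using h
  chart_mem_atlas p := ⟨p, rfl⟩

lemma chartAt_eq (p : OrbitSpace Γ Ω) : chartAt E p = quotChart p := rfl

/-- A local section of the projection, composed with the projection, is locally a translation. -/
lemma sheet_symm_proj (p : OrbitSpace Γ Ω) {x : Ω} (hx : proj Γ Ω x ∈ (sheet p).target) :
    ∃ g : Γ, ∀ᶠ y in 𝓝 x, (sheet p).symm (proj Γ Ω y) = g • y := by
  have hq := isQuotientCoveringMap_proj Γ Ω
  have : ContinuousConstSMul Γ Ω := hq.toContinuousConstSMul
  have sec : ∀ q ∈ (sheet p).target, proj Γ Ω ((sheet p).symm q) = q := fun q hq => by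
    rw [← coe_sheet p]; exact (sheet p).right_inv hq
  have hc : ContinuousAt (fun y => (sheet p).symm (proj Γ Ω y)) x :=
    ((sheet p).continuousAt_symm hx).comp hq.continuous.continuousAt
  obtain ⟨g, hg⟩ := proj_eq_iff.1 (sec _ hx)
  obtain ⟨U, hU, hd⟩ := LinearCoveringAction.wandering (Γ := Γ) ((sheet p).symm (proj Γ Ω x))
  have hg' : ContinuousAt (fun y : Ω => g • y) x := (continuous_const_smul g).continuousAt
  refine ⟨g, ?_⟩
  filter_upwards [hc hU, hg' (show U ∈ 𝓝 (g • x) by rw [hg]; exact hU),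
    hq.continuous.continuousAt ((sheet p).open_target.mem_nhds hx)] with y h1 h2 h3
  obtain ⟨k, hk⟩ := proj_eq_iff.1 ((sec _ h3).trans (hq.map_smul g).symm)
  have := hd k ⟨_, ⟨g • y, h2, hk⟩, h1⟩
  simpa [this] using hk.symm

/-- In the charts of `Ω / Γ`, the projection is locally the restriction of a linear map. -/
lemma quotChart_proj (p : OrbitSpace Γ Ω) {x : Ω} (hx : proj Γ Ω x ∈ (quotChart p).source) :
    ∃ (g : Γ) (L : E →L[ℂ] E), (∀ y : Ω, ((g • y : Ω) : E) = L y) ∧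
      ∀ᶠ y in 𝓝 x, quotChart p (proj Γ Ω y) = L (y : E) := by
  have hx' : proj Γ Ω x ∈ (sheet p).target := by simpa [quotChart] using hx
  obtain ⟨g, hg⟩ := sheet_symm_proj p hx'
  obtain ⟨L, hL⟩ := LinearCoveringAction.exists_linear (Ω := Ω) g
  refine ⟨g, L, hL, hg.mono fun y hy => ?_⟩
  simp [quotChart, hy, hL]

/-- `Ω / Γ` is a complex manifold: the transition maps are locally linear. -/
instance : IsManifold 𝓘(ℂ, E) (ω : WithTop ℕ∞) (OrbitSpace Γ Ω) := by
  refine isManifold_of_contDiffOn _ _ _ ?_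
  rintro _ _ ⟨p, rfl⟩ ⟨p', rfl⟩ z ⟨hz, -⟩
  replace hz : z ∈ ((quotChart p).symm.trans (quotChart p')).source := hz
  refine ContDiffAt.contDiffWithinAt ?_
  have hz1 : z ∈ (quotChart p).target := by
    simpa using ((OpenPartialHomeomorph.trans_source (quotChart p).symm (quotChart p')) ▸ hz).1
  have hz2 : (quotChart p).symm z ∈ (quotChart p').source :=
    ((OpenPartialHomeomorph.trans_source (quotChart p).symm (quotChart p')) ▸ hz).2
  have key : ∀ y ∈ (quotChart p).target, ∃ hy : y ∈ Ω,
      (quotChart p).symm y = proj Γ Ω ⟨y, hy⟩ := by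
    intro y hy
    have hy' := hy
    simp only [quotChart, OpenPartialHomeomorph.trans_target,
      Opens.openPartialHomeomorphSubtypeCoe_target] at hy'
    refine ⟨hy'.1, ?_⟩
    have h3 : (Ω.openPartialHomeomorphSubtypeCoe ⟨p.out⟩).symm y = ⟨y, hy'.1⟩ := by
      apply Subtype.ext
      exact (Ω.openPartialHomeomorphSubtypeCoe ⟨p.out⟩).right_inv (by simpa using hy'.1)
    simp [quotChart, h3, coe_sheet]
  obtain ⟨hzΩ, hz3⟩ := key z hz1
  rw [hz3] at hz2
  obtain ⟨g, L, -, hL⟩ := quotChart_proj p' hz2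
  have hL' : ∀ᶠ y in 𝓝 z, ∀ hy : y ∈ Ω, quotChart p' (proj Γ Ω ⟨y, hy⟩) = L y := by
    rw [← map_nhds_subtype_coe_eq_nhds hzΩ (Ω.isOpen.mem_nhds hzΩ), Filter.eventually_map]
    exact hL.mono fun y hy _ => hy
  refine L.contDiff.contDiffAt.congr_of_eventuallyEq ?_
  filter_upwards [hL', (quotChart p).open_target.mem_nhds hz1] with y hy hy1
  obtain ⟨hyΩ, hy2⟩ := key y hy1
  have := hy hyΩ
  rw [← hy2] at this
  simpa using this

/-- The form on `Ω / Γ` induced by a form `η` on `Ω ⊆ E`: at `p` it is the pull-back of `η` along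
the chart at `p`, a local holomorphic section of the projection. -/
def descend (η : FormField E E) : FormField E (OrbitSpace Γ Ω) := fun p =>
  pullback (fun q : OrbitSpace Γ Ω => chartAt E p q) η p

/-- The restriction to `Ω` of a form on `E`. -/
def restrict (Ω : Opens E) (η : FormField E E) : FormField E Ω :=
  pullback (fun x : Ω => (x : E)) η

lemma mdifferentiable_proj : MDifferentiable 𝓘(ℂ, E) 𝓘(ℂ, E) (proj Γ Ω) := by
  intro x
  have : IsManifold 𝓘(ℂ, E) 1 (OrbitSpace Γ Ω) := IsManifold.of_le (n := ω) le_top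
  have hx := mem_chart_source E (proj Γ Ω x)
  obtain ⟨g, L, -, hL⟩ := quotChart_proj (proj Γ Ω x) hx
  have h1 : MDifferentiableAt 𝓘(ℂ, E) 𝓘(ℂ, E) (fun y : Ω => L (y : E)) x :=
    L.differentiableAt.mdifferentiableAt.comp x
      ((contMDiff_subtype_val (n := 1)).mdifferentiable one_ne_zero x)
  have h2 : MDifferentiableAt 𝓘(ℂ, E) 𝓘(ℂ, E)
      (fun y => chartAt E (proj Γ Ω x) (proj Γ Ω y)) x := h1.congr_of_eventuallyEq hL
  have h3 := mdifferentiableAt_atlas_symm (I := 𝓘(ℂ, E)) (chart_mem_atlas E (proj Γ Ω x))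
    ((chartAt E (proj Γ Ω x)).map_source hx)
  refine (h3.comp x h2).congr_of_eventuallyEq ?_
  filter_upwards [(isQuotientCoveringMap_proj Γ Ω).continuous.continuousAt
    ((chartAt E (proj Γ Ω x)).open_source.mem_nhds hx)] with y hy
  exact ((chartAt E (proj Γ Ω x)).left_inv hy).symm

/-- If `η` is invariant under `Γ`, then the form induced on `Ω / Γ` pulls back to `η`. -/
lemma pullback_proj_descend {η : FormField E E}
    (hη : ∀ (g : Γ) (L : E →L[ℂ] E), (∀ x : Ω, ((g • x : Ω) : E) = L x) →
      ∀ x : Ω, pullForm L (η (L x)) = η x) :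
    pullback (proj Γ Ω) (descend η : FormField E (OrbitSpace Γ Ω)) = restrict Ω η := by
  funext x
  have : IsManifold 𝓘(ℂ, E) 1 (OrbitSpace Γ Ω) := IsManifold.of_le (n := ω) le_top
  have hx := mem_chart_source E (proj Γ Ω x)
  obtain ⟨g, L, hg, hL⟩ := quotChart_proj (proj Γ Ω x) hx
  have hval : MDifferentiableAt 𝓘(ℂ, E) 𝓘(ℂ, E) (fun y : Ω => (y : E)) x :=
    (contMDiff_subtype_val (n := 1)).mdifferentiable one_ne_zero x
  let c : OrbitSpace Γ Ω → E := fun q => chartAt E (proj Γ Ω x) q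
  let A : E →L[ℂ] E := differential c (proj Γ Ω x)
  let B : E →L[ℂ] E := differential (proj Γ Ω) x
  let V : E →L[ℂ] E := differential (fun y : Ω => (y : E)) x
  have h1 : HasMFDerivAt 𝓘(ℂ, E) 𝓘(ℂ, E) (c ∘ proj Γ Ω) x (A.comp B) :=
    (mdifferentiableAt_atlas (chart_mem_atlas E (proj Γ Ω x)) hx).hasMFDerivAt.comp x
      (mdifferentiable_proj x).hasMFDerivAt
  have h2 : HasMFDerivAt 𝓘(ℂ, E) 𝓘(ℂ, E) (c ∘ proj Γ Ω) x (L.comp V) :=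
    HasMFDerivAt.congr_of_eventuallyEq
      (HasMFDerivAt.comp x L.hasFDerivAt.hasMFDerivAt hval.hasMFDerivAt) hL
  have h3 : A.comp B = L.comp V := hasMFDerivAt_unique h1 h2
  have h4 : c (proj Γ Ω x) = L x := hL.self_of_nhds
  have h5 : pullForm (A.comp B) (η (c (proj Γ Ω x))) = pullForm V (η x) := by
    rw [h3, h4, ← hη g L hg x]
    rfl
  exact h5

end Quotients

/-! ### Classical Hopf manifolds -/

section Hopf

variable (E : Type*) [NormedAddCommGroup E] [InnerProductSpace ℂ E]

/-- `E ∖ {0}`. -/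
def punctured : Opens E := ⟨{0}ᶜ, isOpen_compl_singleton⟩

/-- Multiplication by non-zero scalars on `E ∖ {0}`. -/
instance : MulAction ℂˣ (punctured E) where
  smul c z := ⟨(c : ℂ) • (z : E), smul_ne_zero c.ne_zero z.2⟩
  one_smul z := Subtype.ext (one_smul ℂ (z : E))
  mul_smul c d z := Subtype.ext (mul_smul (c : ℂ) (d : ℂ) (z : E))

/-- A complex number `λ ≠ 0` with `|λ| ≠ 1`. -/
structure HopfFactor where
  val : ℂˣ
  norm_ne_one : ‖(val : ℂ)‖ ≠ 1

instance (l : HopfFactor) : LinearCoveringAction (Subgroup.zpowers l.val) (punctured E) where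
  exists_linear g := ⟨((g : ℂˣ) : ℂ) • ContinuousLinearMap.id ℂ E, fun _ => rfl⟩
  wandering x := by
    set a := Real.log ‖(l.val : ℂ)‖ with ha
    have ha0 : a ≠ 0 :=
      Real.log_ne_zero_of_pos_of_ne_one (norm_pos_iff.2 l.val.ne_zero) l.norm_ne_one
    have hx : ∀ y : punctured E, ‖(y : E)‖ ≠ 0 := fun y => norm_ne_zero_iff.2 y.2
    have hc : Continuous fun y : punctured E => Real.log ‖(y : E)‖ :=
      Continuous.log (by fun_prop) hx
    refine ⟨(fun y : punctured E => Real.log ‖(y : E)‖) ⁻¹'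
      Metric.ball (Real.log ‖(x : E)‖) (|a| / 2),
      hc.continuousAt (Metric.ball_mem_nhds _ (by positivity)), ?_⟩
    rintro ⟨g, n, rfl⟩ ⟨_, ⟨y, hy, rfl⟩, hy'⟩
    have key : Real.log ‖(((⟨l.val ^ n, n, rfl⟩ : Subgroup.zpowers l.val) • y : punctured E) : E)‖
        = n * a + Real.log ‖(y : E)‖ := by
      change Real.log ‖((l.val ^ n : ℂˣ) : ℂ) • (y : E)‖ = _
      rw [norm_smul, Real.log_mul (norm_ne_zero_iff.2 (l.val ^ n).ne_zero) (hx y)]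
      simp [ha, Real.log_zpow]
    simp only [Set.mem_preimage, Metric.mem_ball, Real.dist_eq] at hy hy'
    rw [key] at hy'
    have h1 : |(n : ℝ) * a| < |a| := by
      have := abs_sub (n * a + Real.log ‖(y : E)‖ - Real.log ‖(x : E)‖)
        (Real.log ‖(y : E)‖ - Real.log ‖(x : E)‖)
      have h2 : n * a + Real.log ‖(y : E)‖ - Real.log ‖(x : E)‖ -
        (Real.log ‖(y : E)‖ - Real.log ‖(x : E)‖) = n * a := by ring
      rw [h2] at this
      linarith
    rw [abs_mul] at h1
    have h3 : |(n : ℝ)| < 1 := by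
      by_contra h
      push Not at h
      nlinarith [abs_nonneg a]
    have h4 : n = 0 := by
      rw [← Int.abs_lt_one_iff]
      exact_mod_cast h3
    subst h4
    simp

/-- The classical Hopf manifold `(E ∖ {0}) / ⟨λ · id⟩`. -/
abbrev Hopf (l : HopfFactor) : Type _ := OrbitSpace (Subgroup.zpowers l.val) (punctured E)

/-- The lcK form of the classical Hopf manifold, induced by `‖z‖⁻² ω₀` on `E ∖ {0}`. -/
def hopfForm (l : HopfFactor) : FormField E (Hopf E l) :=
  descend fun z => (‖z‖ ^ 2)⁻¹ • flatForm E z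

/-- The form `‖z‖⁻² ω₀` is invariant, so that `hopfForm` pulls back to it. -/
lemma pullback_hopfForm (l : HopfFactor) :
    pullback (proj (Subgroup.zpowers l.val) (punctured E)) (hopfForm E l) =
      restrict (punctured E) fun z => (‖z‖ ^ 2)⁻¹ • flatForm E z := by
  refine pullback_proj_descend fun g L hL x => ?_
  have hLv : ∀ v, L v = ((g : ℂˣ) : ℂ) • v := by
    intro v
    by_cases h : v = 0
    · simp [h]
    · exact (hL ⟨v, h⟩).symm
  have h1 : ‖((g : ℂˣ) : ℂ)‖ ≠ 0 := norm_ne_zero_iff.2 (g : ℂˣ).ne_zero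
  have h2 : ∀ v w : E, (inner ℂ (((g : ℂˣ) : ℂ) • v) (((g : ℂˣ) : ℂ) • w)).im =
      ‖((g : ℂˣ) : ℂ)‖ ^ 2 * (inner ℂ v w).im := by
    intro v w
    rw [inner_smul_left, inner_smul_right, ← mul_assoc, mul_comm (conj _), Complex.mul_conj,
      Complex.normSq_eq_norm_sq, Complex.im_ofReal_mul]
  refine LinearMap.ext fun v => LinearMap.ext fun w => ?_
  have h3 : ‖(x : E)‖ ≠ 0 := norm_ne_zero_iff.2 x.2
  change (‖L x‖ ^ 2)⁻¹ * (inner ℂ (L v) (L w)).im = (‖(x : E)‖ ^ 2)⁻¹ * (inner ℂ v w).im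
  rw [hLv, hLv, hLv, h2, norm_smul]
  field_simp

end Hopf

/-! ### Quotients of `D = {(x, y) ∈ ℂ² : Im (x ȳ) > 0}` -/

section Elliptic

/-- The function `(x, y) ↦ Im (x ȳ)` on `ℂ²`. -/
def imProd (z : Fin 2 → ℂ) : ℝ := (z 0 * conj (z 1)).im

lemma continuous_imProd : Continuous imProd := by
  unfold imProd
  fun_prop

/-- The domain `D` of `ℂ²`. -/
def D : Opens (Fin 2 → ℂ) := ⟨{z | 0 < imProd z}, isOpen_lt continuous_const continuous_imProd⟩

/-- The Kähler form `ω̃ = (1/2) dd^c Φ = (√-1/2) ∂∂̄ Φ` with potential `Φ = Im (x ȳ)⁻¹`. -/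
def kahlerForm : FormField (Fin 2 → ℂ) (Fin 2 → ℂ) := fun z =>
  (1 / 2 : ℝ) • ddc (fun z => (imProd z)⁻¹) z

open Matrix in
/-- The subgroup `G = ℂ^* · SL(2, ℝ)` of `GL(2, ℂ)`. -/
def G : Subgroup (GL (Fin 2) ℂ) where
  carrier := {g | ∃ (c : ℂˣ) (A : SpecialLinearGroup (Fin 2) ℝ),
    g = GeneralLinearGroup.scalar (Fin 2) c * SpecialLinearGroup.mapGL ℂ A}
  mul_mem' := by
    rintro _ _ ⟨c, A, rfl⟩ ⟨d, B, rfl⟩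
    refine ⟨c * d, A * B, ?_⟩
    rw [map_mul, map_mul, mul_assoc, ← mul_assoc (SpecialLinearGroup.mapGL ℂ A),
      ← GeneralLinearGroup.scalar_commute d (SpecialLinearGroup.mapGL ℂ A)]
    simp only [mul_assoc]
  one_mem' := ⟨1, 1, by simp⟩
  inv_mem' := by
    rintro _ ⟨c, A, rfl⟩
    refine ⟨c⁻¹, A⁻¹, ?_⟩
    rw [_root_.mul_inv_rev, map_inv, map_inv, ← map_inv, ← map_inv]
    exact (GeneralLinearGroup.scalar_commute _ _).symm

open Matrix in
/-- `Im (x ȳ)` is multiplied by `|c|²` under `c · A`. -/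
lemma exists_imProd_mulVec (g : G) :
    ∃ c : ℂˣ, ∀ z : Fin 2 → ℂ,
      imProd ((g : GL (Fin 2) ℂ).val *ᵥ z) = ‖(c : ℂ)‖ ^ 2 * imProd z := by
  obtain ⟨_, c, A, rfl⟩ := g
  refine ⟨c, fun z => ?_⟩
  have hA : A.1 0 0 * A.1 1 1 - A.1 0 1 * A.1 1 0 = 1 := by rw [← det_fin_two]; exact A.2
  have hn : ‖(c : ℂ)‖ ^ 2 = (c : ℂ).re ^ 2 + (c : ℂ).im ^ 2 := by
    rw [Complex.sq_norm, Complex.normSq_apply]; ring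
  have h : ∀ i, ((GeneralLinearGroup.scalar (Fin 2) c *
      SpecialLinearGroup.mapGL ℂ A : GL (Fin 2) ℂ).val *ᵥ z) i
      = c * ((A.1 i 0 : ℂ) * z 0 + (A.1 i 1 : ℂ) * z 1) := by
    intro i
    simp [mulVec, dotProduct, Fin.sum_univ_two, GeneralLinearGroup.coe_scalar, scalar_apply]
    ring
  simp only [imProd, h, hn]
  simp [Complex.mul_re, Complex.mul_im, Complex.add_re, Complex.add_im]
  linear_combination ((c : ℂ).re ^ 2 + (c : ℂ).im ^ 2) *
    ((z 0).im * (z 1).re - (z 0).re * (z 1).im) * hA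

open Matrix in
/-- The linear action of `G` on `D`. -/
instance : MulAction G D where
  smul g z := ⟨(g : GL (Fin 2) ℂ).val *ᵥ (z : Fin 2 → ℂ), by
    obtain ⟨c, hc⟩ := exists_imProd_mulVec g
    change 0 < imProd _
    rw [hc]
    exact mul_pos (by have := c.ne_zero; positivity) z.2⟩
  one_smul z := Subtype.ext (one_mulVec (z : Fin 2 → ℂ))
  mul_smul g h z := Subtype.ext (mulVec_mulVec (z : Fin 2 → ℂ) g.1.val h.1.val).symm

variable (Γ : Subgroup G) [DiscreteTopology Γ] [ProperSMul Γ D] [IsCancelSMul Γ D]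

instance : LinearCoveringAction Γ D where
  exists_linear g :=
    ⟨(Matrix.mulVecLin (g : G).1.val).toContinuousLinearMap, fun _ => rfl⟩
  wandering x := by
    have : LocallyCompactSpace D := D.isOpen.locallyCompactSpace
    have : ContinuousSMul Γ D := ProperSMul.toContinuousSMul
    have : ContinuousConstSMul Γ D := ContinuousSMul.continuousConstSMul
    have : ProperlyDiscontinuousSMul Γ D :=
      properlyDiscontinuousSMul_iff_properSMul.2 inferInstance
    exact (isQuotientCoveringMap_quotientMk_of_properlyDiscontinuousSMul (G := Γ) (E := D)).disjoint x

/-- The complex surface `D / Γ`, for a discrete subgroup `Γ` of `G` acting freely and properly. -/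
abbrev Surface : Type := OrbitSpace Γ D

/-- Belgun's lcK form on `D / Γ`, induced by `(1/2) Im (x ȳ) dd^c (Im (x ȳ)⁻¹)` on `D`. -/
def belgunForm : FormField (Fin 2 → ℂ) (Surface Γ) :=
  descend fun z => imProd z • kahlerForm z

/-- The form `(1/2) Im (x ȳ) dd^c (Im (x ȳ)⁻¹)` is invariant, so that `belgunForm` pulls back
to it. -/
lemma pullback_belgunForm :
    pullback (proj Γ D) (belgunForm Γ) = restrict D fun z => imProd z • kahlerForm z := by
  refine pullback_proj_descend fun g L hL x => ?_
  obtain ⟨c, hc⟩ := exists_imProd_mulVec (g : G)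
  have hc0 : ‖(c : ℂ)‖ ^ 2 ≠ 0 := pow_ne_zero 2 (norm_ne_zero_iff.2 c.ne_zero)
  let M : (Fin 2 → ℂ) ≃L[ℂ] (Fin 2 → ℂ) := ContinuousLinearEquiv.equivOfInverse
    (Matrix.mulVecLin (g : G).1.val).toContinuousLinearMap
    (Matrix.mulVecLin (g : G).1⁻¹.val).toContinuousLinearMap
    (fun z => by
      change (g : G).1⁻¹.val.mulVec ((g : G).1.val.mulVec z) = z
      rw [Matrix.mulVec_mulVec, ← Units.val_mul, inv_mul_cancel, Units.val_one, Matrix.one_mulVec])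
    (fun z => by
      change (g : G).1.val.mulVec ((g : G).1⁻¹.val.mulVec z) = z
      rw [Matrix.mulVec_mulVec, ← Units.val_mul, mul_inv_cancel, Units.val_one, Matrix.one_mulVec])
  have hM : ∀ z, imProd (M z) = ‖(c : ℂ)‖ ^ 2 * imProd z := hc
  have hLM : L = M := by
    have h1 : (fun z => L z) =ᶠ[𝓝 (x : Fin 2 → ℂ)] fun z => M z := by
      filter_upwards [D.isOpen.mem_nhds x.2] with z hz
      exact (hL ⟨z, hz⟩).symm
    exact (L.hasFDerivAt (x := (x : Fin 2 → ℂ))).unique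
      ((M : (Fin 2 → ℂ) →L[ℂ] (Fin 2 → ℂ)).hasFDerivAt.congr_of_eventuallyEq h1)
  have h2 : pullForm (M : (Fin 2 → ℂ) →L[ℂ] (Fin 2 → ℂ)) (ddc (fun z => (imProd z)⁻¹) (M x)) =
      (‖(c : ℂ)‖ ^ 2)⁻¹ • ddc (fun z => (imProd z)⁻¹) (x : Fin 2 → ℂ) := by
    rw [pullForm_ddc, ← ddc_const_mul]
    simp only [hM, mul_inv]
  rw [hLM]
  refine LinearMap.ext fun v => LinearMap.ext fun w => ?_
  have h3 : ddc (fun z => (imProd z)⁻¹) (M x) (M v) (M w) =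
      (‖(c : ℂ)‖ ^ 2)⁻¹ * ddc (fun z => (imProd z)⁻¹) (x : Fin 2 → ℂ) v w :=
    congrArg (fun B : LinearMap.BilinForm ℝ (Fin 2 → ℂ) => B v w) h2
  change imProd (M x) * (1 / 2 * ddc (fun z => (imProd z)⁻¹) (M x) (M v) (M w)) =
    imProd x * (1 / 2 * ddc (fun z => (imProd z)⁻¹) (x : Fin 2 → ℂ) v w)
  rw [h3, hM]
  field_simp

end Elliptic

/-- The Hilbert space `l²(ℂ)`. -/
abbrev EllTwo : Type := lp (fun _ : ℕ => ℂ) 2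

end LcK

/-! On the diagonal `1 / imProd p` equals 2i / `wedge p p`, so the metric conditions extend to
identities between pairs (p, q), holomorphic in p and antiholomorphic in q. These show that a map as
in the theorem remembers the complex line through each point of `D`, so that Γ would have to
preserve every such line. The height Im (x / y) would then descend to a continuous unbounded
function on the compact quotient (`exists_line_moved`).

Hopf targets. Let f be a local lift to the Hilbert space. By `conformal_polarized`, for fixed q and
v the function p ↦ ⟨df_q v, f p⟩ has differential M dφ, with M = ⟨f q, f p⟩ · `wedge p q` and φ
explicit. Symmetry of second derivatives gives dM ∧ dφ = 0. As v varies the dφ span the cotangent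
space, so M is constant (`conformal_inner_mul_wedge`). Hence `wedge` determines the angle between f
p and f q, and these are parallel only if p and q are. Local lifts need not glue over `D`, but the
angle is independent of the lift, and real analyticity carries its formula to all of `D`
(`norm_inner_out`).

Hilbert space targets. The radial derivative df_p p is insensitive to translations of the target and
satisfies ⟨df_q q, df_p p⟩ = 2i / `wedge p q` on all of D × D (`inner_fderiv_radial`). Equivariance
ψ(γz) = χ ψ(z) passes to radial derivatives and forces χ γz = z. So γ preserves all lines, and χ = 1
forces γ = 1 by freeness. -/

namespace LcK

/-! ### Polarization -/

section Polarization

variable {V : Type*} [NormedAddCommGroup V] [NormedSpace ℂ V]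
  {E : Type*} [NormedAddCommGroup E] [InnerProductSpace ℂ E]

/-- A function that is holomorphic in the first and antiholomorphic in the second variable, and
vanishes on the diagonal, is zero. -/
lemma eq_zero_of_diagonal {U : Set V} (hU : Convex ℝ U) (hUo : IsOpen U) (T : V → V → ℂ)
    (hT : ∀ (m n : V) (s : ℂ), m + s • n ∈ U → m + conj s • n ∈ U →
      DifferentiableAt ℂ (fun s : ℂ => T (m + s • n) (m + conj s • n)) s)
    (h0 : ∀ p ∈ U, T p p = 0) {p q : V} (hp : p ∈ U) (hq : q ∈ U) : T p q = 0 := by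
  -- The pair (m + s n, m + s̄ n) lies on the diagonal for real s and equals (p, q) at s = i. The
  -- identity theorem in s carries the vanishing from real s near 0 to s = i.
  set m : V := (1 / 2 : ℂ) • (p + q) with hm
  set n : V := (-Complex.I / 2) • (p - q) with hn
  have hIp : m + Complex.I • n = p := by
    rw [hm, hn, smul_smul, show Complex.I * (-Complex.I / 2) = 1 / 2 by
      linear_combination (-1 / 2 : ℂ) * Complex.I_mul_I]
    module
  have hIq : m + conj Complex.I • n = q := by
    rw [hm, hn, Complex.conj_I, smul_smul, show -Complex.I * (-Complex.I / 2) = -1 / 2 by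
      linear_combination (1 / 2 : ℂ) * Complex.I_mul_I]
    module
  let W : Set ℂ := {s | m + s • n ∈ U ∧ m + conj s • n ∈ U}
  have hWo : IsOpen W := (hUo.preimage (by fun_prop)).inter
    (hUo.preimage (continuous_const.add (Complex.continuous_conj.smul continuous_const)))
  have hWc : Convex ℝ W := by
    intro s hs t ht a b ha hb hab
    have e : ∀ x y : ℂ, m + (a • x + b • y) • n = a • (m + x • n) + b • (m + y • n) := by
      intro x y
      have h1 : m = a • m + b • m := by rw [← add_smul, hab, one_smul]
      conv_lhs => rw [h1]
      rw [add_smul, smul_assoc, smul_assoc, smul_add, smul_add]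
      abel
    refine ⟨?_, ?_⟩
    · rw [e]; exact hU hs.1 ht.1 ha hb hab
    · have : conj (a • s + b • t) = a • conj s + b • conj t := by simp
      rw [this, e]
      exact hU hs.2 ht.2 ha hb hab
  have h0W : (0 : ℂ) ∈ W := by
    have : m ∈ U := by
      have h := hU hp hq (a := 1 / 2) (b := 1 / 2) (by norm_num) (by norm_num) (by norm_num)
      convert h using 1
      rw [hm, smul_add, ← Complex.coe_smul, ← Complex.coe_smul]
      norm_num
    simp [W, this]
  have hIW : Complex.I ∈ W := ⟨by rw [hIp]; exact hp, by rw [hIq]; exact hq⟩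
  have han : AnalyticOnNhd ℂ (fun s : ℂ => T (m + s • n) (m + conj s • n)) W :=
    DifferentiableOn.analyticOnNhd
      (fun s hs => (hT m n s hs.1 hs.2).differentiableWithinAt) hWo
  have hfreq : ∃ᶠ s : ℂ in 𝓝[≠] 0, T (m + s • n) (m + conj s • n) = 0 := by
    have ht : Filter.Tendsto (fun x : ℝ => (x : ℂ)) (𝓝[≠] 0) (𝓝[≠] 0) := by
      refine tendsto_nhdsWithin_iff.2 ⟨?_, ?_⟩
      · have := (Complex.continuous_ofReal.tendsto 0).mono_left
          (nhdsWithin_le_nhds (s := {(0 : ℝ)}ᶜ))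
        simpa using this
      · filter_upwards [self_mem_nhdsWithin] with x hx
        simpa using hx
    refine ht.frequently (Filter.Eventually.frequently ?_)
    have h1 : ∀ᶠ x : ℝ in 𝓝[≠] 0, (x : ℂ) ∈ W :=
      ht.eventually (nhdsWithin_le_nhds (hWo.mem_nhds h0W))
    filter_upwards [h1] with x hx
    rw [Complex.conj_ofReal]
    exact h0 _ hx.1
  have := han.eqOn_zero_of_preconnected_of_frequently_eq_zero hWc.isPreconnected h0W hfreq hIW
  simpa only [hIp, hIq, Pi.zero_apply] using this

/-- The inner product is conjugate linear in its first slot, which cancels the conjugation of the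
argument: the real derivative is complex linear. -/
lemma differentiableAt_inner_conj {a b : ℂ → E} {s : ℂ} (ha : DifferentiableAt ℂ a (conj s))
    (hb : DifferentiableAt ℂ b s) :
    DifferentiableAt ℂ (fun s : ℂ => inner ℂ (a (conj s)) (b s)) s := by
  have h1 : HasFDerivAt (fun s : ℂ => a (conj s)) _ s :=
    HasFDerivAt.comp s (ha.hasFDerivAt.restrictScalars ℝ) Complex.conjCLE.hasFDerivAt
  have h2 := h1.inner ℂ (hb.hasFDerivAt.restrictScalars ℝ)
  refine (hasFDerivAt_of_restrictScalars ℝ h2 (f' := ContinuousLinearMap.toSpanSingleton ℂ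
    (inner ℂ (a (conj s)) (fderiv ℂ b s 1) + inner ℂ (fderiv ℂ a (conj s) 1) (b s))) ?_
    ).differentiableAt
  refine ContinuousLinearMap.ext fun t => ?_
  have hl : ∀ (L : ℂ →L[ℂ] E) (t : ℂ), L t = t • L 1 := fun L t => by
    rw [← map_smul, smul_eq_mul, mul_one]
  simp [fderivInnerCLM_apply, hl _ t, hl _ (conj t), inner_smul_left, inner_smul_right]
  ring

end Polarization

/-! ### The Hermitian pairing and the Kähler form -/

/-- The Hermitian pairing `p₀ q̄₁ - p₁ q̄₀` of `ℂ²`. -/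
def wedge (p q : Fin 2 → ℂ) : ℂ := p 0 * conj (q 1) - p 1 * conj (q 0)

/-- The numerator of the mixed second derivative of `1 / wedge p q`, in the directions
`w` and `v`. -/
def hess (p q v w : Fin 2 → ℂ) : ℂ := 2 * wedge w q * wedge p v - wedge w v * wedge p q

lemma wedge_conj (p q : Fin 2 → ℂ) : conj (wedge p q) = -wedge q p := by
  simp [wedge]; ring

lemma wedge_self (p : Fin 2 → ℂ) : wedge p p = 2 * Complex.I * imProd p := by
  apply Complex.ext <;> simp [wedge, imProd] <;> ring

/-- The imaginary part of `wedge`, which is the polar form of `imProd`. -/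
def wedgeIm : (Fin 2 → ℂ) →L[ℝ] (Fin 2 → ℂ) →L[ℝ] ℝ :=
  LinearMap.toContinuousBilinearMap <| LinearMap.mk₂ ℝ (fun v w => (wedge v w).im)
    (by intros; simp [wedge]; ring) (by intros; simp [wedge]; ring)
    (by intros; simp [wedge]; ring) (by intros; simp [wedge]; ring)

lemma wedgeIm_apply (v w : Fin 2 → ℂ) : wedgeIm v w = (wedge v w).im := rfl

lemma hasFDerivAt_imProd (z : Fin 2 → ℂ) : HasFDerivAt imProd (wedgeIm z) z := by
  have h1 : imProd = fun z => (1 / 2 : ℝ) * wedgeIm z z := by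
    funext z
    simp [wedgeIm_apply, wedge_self]
  have h2 : HasFDerivAt (fun z => wedgeIm z z) _ z :=
    wedgeIm.hasFDerivAt.clm_apply (hasFDerivAt_id z)
  rw [h1]
  refine (h2.const_mul (1 / 2 : ℝ)).congr_fderiv ?_
  ext v
  simp [wedgeIm_apply, wedge]
  ring

/-- The associated Hermitian form is the mixed derivative 2i `hess` / `wedge` ³ of the kernel 2i /
`wedge`; at `wedge z z` = 2i `imProd z` the constant is 2i / (2i)³ = -1/4. -/
lemma kahlerForm_apply {z : Fin 2 → ℂ} (hz : z ∈ D) (v w : Fin 2 → ℂ) :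
    kahlerForm z v w = -(hess z z v w).im / (4 * imProd z ^ 3) := by
  have hz0 : imProd z ≠ 0 := ne_of_gt hz
  -- The one-form d^c (1 / `imProd`) is a scalar function times `C x`, which is real linear in x, so
  -- the product rule computes its derivative.
  let C : (Fin 2 → ℂ) →L[ℝ] (Fin 2 → ℂ) →L[ℝ] ℝ :=
    ((ContinuousLinearMap.compL ℝ (Fin 2 → ℂ) (Fin 2 → ℂ) ℝ).flip (cplx (Fin 2 → ℂ))).comp wedgeIm
  have hC : ∀ x v, C x v = wedgeIm x (Complex.I • v) := fun _ _ => rfl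
  have hdc : ∀ x ∈ D, dc (fun z => (imProd z)⁻¹) x = (1 / 2 * (imProd x ^ 2)⁻¹) • C x := by
    intro x hx
    have hx0 : imProd x ≠ 0 := ne_of_gt hx
    have h1 : HasFDerivAt (fun z => (imProd z)⁻¹) (-(imProd x ^ 2)⁻¹ • wedgeIm x) x :=
      (hasDerivAt_inv hx0).comp_hasFDerivAt x (hasFDerivAt_imProd x)
    ext v
    simp [dc, h1.fderiv, hC, cplx]
    ring
  have h2 : HasFDerivAt (fun x => 1 / 2 * (imProd x ^ 2)⁻¹)
      ((-(imProd z ^ 3)⁻¹) • wedgeIm z) z := by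
    have := ((hasDerivAt_inv (pow_ne_zero 2 hz0)).comp_hasFDerivAt z
      ((hasFDerivAt_imProd z).pow 2)).const_mul (1 / 2 : ℝ)
    refine this.congr_fderiv ?_
    ext v
    simp
    field_simp
  have h3 : HasFDerivAt (dc fun z => (imProd z)⁻¹) _ z :=
    (h2.smul C.hasFDerivAt).congr_of_eventuallyEq
      (Filter.eventually_of_mem (D.isOpen.mem_nhds hz) hdc)
  have h4 : kahlerForm z v w = 1 / 2 * (fderiv ℝ (dc fun z => (imProd z)⁻¹) z v w -
    fderiv ℝ (dc fun z => (imProd z)⁻¹) z w v) := rfl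
  have h5 : (hess z z v w).im = 2 * (wedge w z * wedge z v).im
      - 2 * imProd z * (wedge w v).re := by
    simp [hess, wedge_self]; ring
  rw [h4, h3.fderiv, h5]
  simp [hC, wedgeIm_apply]
  field_simp
  simp [wedge]
  ring

/-! ### Polarized metric identities and rigidity of local conformal maps -/

section Local

variable {E : Type*} [NormedAddCommGroup E] [InnerProductSpace ℂ E]

/-- `|p₀ q̄₁ - p₁ q̄₀|² = |p₀ q₁ - p₁ q₀|² + 4 Im (p₀ p̄₁) Im (q₀ q̄₁)`. -/
lemma norm_wedge_sq (p q : Fin 2 → ℂ) :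
    ‖wedge p q‖ ^ 2 = ‖p 0 * q 1 - p 1 * q 0‖ ^ 2 + 4 * imProd p * imProd q := by
  simp only [Complex.sq_norm, Complex.normSq_apply, wedge, imProd]
  simp
  ring

lemma wedge_ne_zero {p q : Fin 2 → ℂ} (hp : p ∈ D) (hq : q ∈ D) : wedge p q ≠ 0 := by
  have h1 : 0 < imProd p * imProd q := mul_pos hp hq
  have h2 := norm_wedge_sq p q
  intro h
  rw [h, norm_zero] at h2
  nlinarith [sq_nonneg ‖p 0 * q 1 - p 1 * q 0‖]

/-- The linear form `p ↦ wedge p v`. -/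
def wedgeLeft (v : Fin 2 → ℂ) : (Fin 2 → ℂ) →L[ℂ] ℂ :=
  conj (v 1) • ContinuousLinearMap.proj 0 - conj (v 0) • ContinuousLinearMap.proj 1

lemma wedgeLeft_apply (p v : Fin 2 → ℂ) : wedgeLeft v p = wedge p v := by
  simp [wedgeLeft, wedge]; ring

lemma hasFDerivAt_wedge (p v : Fin 2 → ℂ) : HasFDerivAt (fun p => wedge p v) (wedgeLeft v) p := by
  have h : (fun p => wedge p v) = wedgeLeft v := funext fun p => (wedgeLeft_apply p v).symm
  rw [h]
  exact (wedgeLeft v).hasFDerivAt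

lemma contDiff_wedge (v : Fin 2 → ℂ) {n : WithTop ℕ∞} : ContDiff ℂ n fun p => wedge p v := by
  have h : (fun p => wedge p v) = wedgeLeft v := funext fun p => (wedgeLeft_apply p v).symm
  rw [h]
  exact (wedgeLeft v).contDiff

lemma differentiable_wedge_conj (a b m n : Fin 2 → ℂ) :
    Differentiable ℂ fun s : ℂ => wedge (a + s • b) (m + conj s • n) := by
  simp only [wedge, Pi.add_apply, Pi.smul_apply, smul_eq_mul, map_add, map_mul, Complex.conj_conj]
  fun_prop

lemma differentiable_hess_conj (m n v w : Fin 2 → ℂ) :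
    Differentiable ℂ fun s : ℂ => hess (m + s • n) (m + conj s • n) v w := by
  have h1 := differentiable_wedge_conj m n m n
  have h2 := differentiable_wedge_conj w 0 m n
  have h3 := differentiable_wedge_conj m n v 0
  simp only [smul_zero, add_zero] at h2 h3
  unfold hess
  fun_prop

variable {U : Set (Fin 2 → ℂ)} {f : (Fin 2 → ℂ) → E}

lemma differentiableAt_fderiv_apply {p : Fin 2 → ℂ} (hf : ContDiffAt ℂ ω f p) (v : Fin 2 → ℂ) :
    DifferentiableAt ℂ (fun p => fderiv ℂ f p v) p :=
  ((hf.fderiv_right (m := 1) le_top).differentiableAt one_ne_zero).clm_apply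
    (differentiableAt_const v)

lemma differentiableAt_inner_fderiv_conj (hf : ∀ p ∈ U, ContDiffAt ℂ ω f p)
    (m n v w : Fin 2 → ℂ) (s : ℂ) (hs : m + s • n ∈ U) (hs' : m + conj s • n ∈ U) :
    DifferentiableAt ℂ
      (fun s : ℂ => inner ℂ (fderiv ℂ f (m + conj s • n) v) (fderiv ℂ f (m + s • n) w)) s := by
  refine differentiableAt_inner_conj (a := fun s => fderiv ℂ f (m + s • n) v) ?_ ?_
  · exact (differentiableAt_fderiv_apply (hf _ hs') v).comp (conj s)
      (f := fun s : ℂ => m + s • n) (by fun_prop)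
  · exact (differentiableAt_fderiv_apply (hf _ hs) w).comp s
      (f := fun s : ℂ => m + s • n) (by fun_prop)

lemma differentiableAt_inner_self_conj (hf : ∀ p ∈ U, ContDiffAt ℂ ω f p)
    (m n : Fin 2 → ℂ) (s : ℂ) (hs : m + s • n ∈ U) (hs' : m + conj s • n ∈ U) :
    DifferentiableAt ℂ (fun s : ℂ => inner ℂ (f (m + conj s • n)) (f (m + s • n))) s := by
  have h : ∀ t : ℂ, m + t • n ∈ U → DifferentiableAt ℂ (fun s : ℂ => f (m + s • n)) t :=
    fun t ht => ((hf _ ht).differentiableAt (by simp)).comp t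
      (f := fun s : ℂ => m + s • n) (by fun_prop)
  exact differentiableAt_inner_conj (a := fun s => f (m + s • n)) (h _ hs') (h _ hs)

/-- Both sides are holomorphic in p and antiholomorphic in q, so the diagonal case suffices. -/
lemma conformal_polarized (hU : Convex ℝ U) (hUo : IsOpen U)
    (hf : ∀ p ∈ U, ContDiffAt ℂ ω f p)
    (h : ∀ p ∈ U, ∀ v w, inner ℂ (fderiv ℂ f p v) (fderiv ℂ f p w) * wedge p p ^ 2 =
      inner ℂ (f p) (f p) * hess p p v w)
    {p q : Fin 2 → ℂ} (hp : p ∈ U) (hq : q ∈ U) (v w : Fin 2 → ℂ) :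
    inner ℂ (fderiv ℂ f q v) (fderiv ℂ f p w) * wedge p q ^ 2 =
      inner ℂ (f q) (f p) * hess p q v w := by
  refine sub_eq_zero.1 (eq_zero_of_diagonal hU hUo (fun p q =>
    inner ℂ (fderiv ℂ f q v) (fderiv ℂ f p w) * wedge p q ^ 2 -
      inner ℂ (f q) (f p) * hess p q v w) ?_ (fun p hp => sub_eq_zero.2 (h p hp v w)) hp hq)
  intro m n s hs hs'
  exact ((differentiableAt_inner_fderiv_conj hf m n v w s hs hs').mul
    ((differentiable_wedge_conj m n m n s).pow 2)).sub
    ((differentiableAt_inner_self_conj hf m n s hs hs').mul (differentiable_hess_conj m n v w s))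

lemma isometric_polarized (hU : Convex ℝ U) (hUo : IsOpen U)
    (hf : ∀ p ∈ U, ContDiffAt ℂ ω f p)
    (h : ∀ p ∈ U, ∀ v w, inner ℂ (fderiv ℂ f p v) (fderiv ℂ f p w) * wedge p p ^ 3 =
      2 * Complex.I * hess p p v w)
    {p q : Fin 2 → ℂ} (hp : p ∈ U) (hq : q ∈ U) (v w : Fin 2 → ℂ) :
    inner ℂ (fderiv ℂ f q v) (fderiv ℂ f p w) * wedge p q ^ 3 =
      2 * Complex.I * hess p q v w := by
  refine sub_eq_zero.1 (eq_zero_of_diagonal hU hUo (fun p q =>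
    inner ℂ (fderiv ℂ f q v) (fderiv ℂ f p w) * wedge p q ^ 3 -
      2 * Complex.I * hess p q v w) ?_ (fun p hp => sub_eq_zero.2 (h p hp v w)) hp hq)
  intro m n s hs hs'
  exact ((differentiableAt_inner_fderiv_conj hf m n v w s hs hs').mul
    ((differentiable_wedge_conj m n m n s).pow 3)).sub
    ((differentiable_hess_conj m n v w s).const_mul _)

/-- If `dk = M dφ`, then `dM ∧ dφ = 0`. -/
lemma fderiv_mul_comm_of_fderiv_eq_smul {V : Type*} [NormedAddCommGroup V] [NormedSpace ℂ V]
    {k M φ : V → ℂ} {p : V} (hk : ContDiffAt ℂ ω k p) (hφ : ContDiffAt ℂ ω φ p)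
    (hM : DifferentiableAt ℂ M p)
    (h : fderiv ℂ k =ᶠ[𝓝 p] fun x => M x • fderiv ℂ φ x) (u w : V) :
    fderiv ℂ M p u * fderiv ℂ φ p w = fderiv ℂ M p w * fderiv ℂ φ p u := by
  have h1 : HasFDerivAt (fderiv ℂ k) _ p := (hM.hasFDerivAt.smul
    ((hφ.fderiv_right (m := 1) le_top).differentiableAt
      one_ne_zero).hasFDerivAt).congr_of_eventuallyEq h
  -- The second derivative of k is dM ⊗ dφ + M d²φ; it and d²φ are symmetric, hence so is dM ⊗ dφ.
  have h2 := (hk.isSymmSndFDerivAt le_top) u w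
  have h3 := (hφ.isSymmSndFDerivAt le_top) u w
  rw [h1.fderiv] at h2
  simp only [add_apply, smul_apply,
    ContinuousLinearMap.smulRight_apply, smul_eq_mul, h3] at h2
  exact add_left_cancel h2

/-- This is the explicit φ: the antiholomorphic derivative of 1 / `wedge p q` in q along v. -/
lemma hasFDerivAt_wedge_div {p q : Fin 2 → ℂ} (h : wedge p q ≠ 0) (v : Fin 2 → ℂ) :
    ∃ L : (Fin 2 → ℂ) →L[ℂ] ℂ, (∀ w, L w = hess p q v w / wedge p q ^ 3) ∧
      HasFDerivAt (fun p => -wedge p v * (wedge p q ^ 2)⁻¹) L p := by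
  refine ⟨_, fun w => ?_, (hasFDerivAt_wedge p v).neg.mul
    ((hasDerivAt_inv (pow_ne_zero 2 h)).comp_hasFDerivAt p ((hasFDerivAt_wedge p q).pow 2))⟩
  simp [wedgeLeft_apply, hess]
  field_simp
  ring

/-- The polarized identity reads d⟨df_q v, f⟩ = M dφ for every v. Thus dM is proportional to dφ for
every v; two choices of v give independent dφ, so dM = 0. -/
lemma conformal_inner_mul_wedge (hU : Convex ℝ U) (hUo : IsOpen U) (hUD : U ⊆ D)
    (hf : ∀ p ∈ U, ContDiffAt ℂ ω f p)
    (h : ∀ p ∈ U, ∀ v w, inner ℂ (fderiv ℂ f p v) (fderiv ℂ f p w) * wedge p p ^ 2 =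
      inner ℂ (f p) (f p) * hess p p v w)
    {p p' q : Fin 2 → ℂ} (hp : p ∈ U) (hp' : p' ∈ U) (hq : q ∈ U) :
    inner ℂ (f q) (f p) * wedge p q = inner ℂ (f q) (f p') * wedge p' q := by
  set M : (Fin 2 → ℂ) → ℂ := fun p => inner ℂ (f q) (f p) * wedge p q with hMdef
  have hM : ∀ p ∈ U, DifferentiableAt ℂ M p := fun p hp =>
    ((innerSL ℂ (f q)).differentiableAt.comp p ((hf p hp).differentiableAt (by simp))).mul
      (hasFDerivAt_wedge p q).differentiableAt
  have key : ∀ p ∈ U, ∀ v u w, fderiv ℂ M p u * hess p q v w = fderiv ℂ M p w * hess p q v u := by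
    intro p hp v u w
    have hw : ∀ x ∈ U, wedge x q ≠ 0 := fun x hx => wedge_ne_zero (hUD hx) (hUD hq)
    have hk : ContDiffAt ℂ ω (fun x => innerSL ℂ (fderiv ℂ f q v) (f x)) p :=
      (innerSL ℂ (fderiv ℂ f q v)).contDiff.contDiffAt.comp p (hf p hp)
    have hφ : ContDiffAt ℂ ω (fun x => -wedge x v * (wedge x q ^ 2)⁻¹) p :=
      (contDiff_wedge v).neg.contDiffAt.mul
        (((contDiff_wedge q).contDiffAt.pow 2).inv (pow_ne_zero 2 (hw p hp)))
    have := fderiv_mul_comm_of_fderiv_eq_smul hk hφ (hM p hp) ?_ u w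
    · obtain ⟨L, hL, hL'⟩ := hasFDerivAt_wedge_div (hw p hp) v
      rw [hL'.fderiv, hL, hL, mul_div_assoc', mul_div_assoc',
        div_left_inj' (pow_ne_zero 3 (hw p hp))] at this
      exact this
    · filter_upwards [hUo.mem_nhds hp] with x hx
      obtain ⟨L, hL, hL'⟩ := hasFDerivAt_wedge_div (hw x hx) v
      have h1 : HasFDerivAt (fun x => innerSL ℂ (fderiv ℂ f q v) (f x)) _ x :=
        (innerSL ℂ (fderiv ℂ f q v)).hasFDerivAt.comp x
          ((hf x hx).differentiableAt (by simp)).hasFDerivAt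
      rw [h1.fderiv, hL'.fderiv]
      ext1 w
      have h2 := conformal_polarized hU hUo hf h hx hq v w
      have h3 := hw x hx
      simp only [ContinuousLinearMap.comp_apply, smul_apply, hL, smul_eq_mul,
        innerSL_apply_apply, hMdef]
      field_simp
      linear_combination h2
  have hq0 : wedge q q ≠ 0 := wedge_ne_zero (hUD hq) (hUD hq)
  have hzero : ∀ p ∈ U, fderiv ℂ M p = 0 := by
    intro p hp
    have hpq : wedge p q ≠ 0 := wedge_ne_zero (hUD hp) (hUD hq)
    -- The vector c spans the kernel of `wedge · q`. Taking v = q, for which dφ kills c but not p,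
    -- gives dM(c) = 0; taking v = c, for which dφ(c) ≠ 0, gives dM = 0.
    set c : Fin 2 → ℂ := fun i => conj (q i) with hc
    have e1 : wedge c q = 0 := by simp [wedge, hc]; ring
    have e2 : wedge c c = -wedge q q := by simp [wedge, hc]; ring
    have h1 : fderiv ℂ M p c = 0 := by
      have h2 : hess p q q p = wedge p q * wedge p q := by unfold hess; ring
      have h3 : hess p q q c = 0 := by simp [hess, e1]
      have := key p hp q c p
      simpa [h2, h3, hpq] using this
    ext1 u
    have := key p hp c u c
    simpa [hess, e1, e2, h1, hpq, hq0] using this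
  refine hU.is_const_of_fderivWithin_eq_zero (𝕜 := ℂ) (f := M)
    (fun x hx => (hM x hx).differentiableWithinAt) (fun x hx => ?_) hp hp'
  rw [fderivWithin_of_isOpen hUo hx, hzero x hx]

/-- The product of the moduli of two constancy statements, with p and with q as the fixed point. -/
lemma conformal_norm_inner (hU : Convex ℝ U) (hUo : IsOpen U) (hUD : U ⊆ D)
    (hf : ∀ p ∈ U, ContDiffAt ℂ ω f p)
    (h : ∀ p ∈ U, ∀ v w, inner ℂ (fderiv ℂ f p v) (fderiv ℂ f p w) * wedge p p ^ 2 =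
      inner ℂ (f p) (f p) * hess p p v w)
    {p q : Fin 2 → ℂ} (hp : p ∈ U) (hq : q ∈ U) :
    ‖(inner ℂ (f p) (f q) : ℂ)‖ ^ 2 * ‖wedge q p‖ ^ 2 =
      4 * imProd p * imProd q * (‖f p‖ ^ 2 * ‖f q‖ ^ 2) := by
  have h1 := congrArg norm (conformal_inner_mul_wedge hU hUo hUD hf h hq hp hp)
  have h2 := congrArg norm (conformal_inner_mul_wedge hU hUo hUD hf h hp hq hq)
  have e : ∀ x ∈ U, ‖wedge x x‖ = 2 * imProd x := fun x hx => by
    have : 0 < imProd x := hUD hx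
    simp [wedge_self, abs_of_pos this]
  have e2 : ‖wedge p q‖ = ‖wedge q p‖ := by rw [← norm_neg, ← wedge_conj, Complex.norm_conj]
  simp only [norm_mul, e _ hp, e _ hq, e2, norm_inner_symm (f q) (f p),
    inner_self_eq_norm_sq_to_K, norm_pow] at h1 h2
  simp at h1 h2
  calc _ = (‖(inner ℂ (f p) (f q) : ℂ)‖ * ‖wedge q p‖) *
        (‖(inner ℂ (f p) (f q) : ℂ)‖ * ‖wedge q p‖) := by ring
    _ = (‖f p‖ ^ 2 * (2 * imProd p)) * (‖f q‖ ^ 2 * (2 * imProd q)) := by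
      nth_rewrite 1 [h1]
      rw [h2]
    _ = _ := by ring

end Local

/-! ### Calculus on open subsets and on quotients -/

section OpenSubsets

variable {E : Type*} [NormedAddCommGroup E] [NormedSpace ℂ E]
  {E' : Type*} [NormedAddCommGroup E'] [NormedSpace ℂ E']
  {M : Type*} [TopologicalSpace M] [ChartedSpace E' M] {Ω : Opens E}

lemma hasMFDerivAt_subtype_val (x : Ω) :
    HasMFDerivAt 𝓘(ℂ, E) 𝓘(ℂ, E) (fun y : Ω => (y : E)) x (ContinuousLinearMap.id ℂ E) := by
  have h : ∀ y ∈ Ω, (((chartAt E x).symm y : Ω) : E) = y := fun y hy => by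
    have hy' : y ∈ (Ω.openPartialHomeomorphSubtypeCoe ⟨x⟩).target := by
      rwa [Opens.openPartialHomeomorphSubtypeCoe_target]
    exact (Ω.openPartialHomeomorphSubtypeCoe ⟨x⟩).right_inv hy'
  refine ⟨continuous_subtype_val.continuousAt, ?_⟩
  exact (hasFDerivWithinAt_id _ _).congr_of_eventuallyEq
    (nhdsWithin_le_nhds (Filter.eventually_of_mem (Ω.isOpen.mem_nhds x.2) h)) (h x x.2)

lemma restrict_apply (η : FormField E E) (x : Ω) : restrict Ω η x = η x := by
  have : differential (fun y : Ω => (y : E)) x = ContinuousLinearMap.id ℂ E :=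
    (hasMFDerivAt_subtype_val x).mfderiv
  unfold restrict pullback
  rw [this]
  rfl

lemma pullback_comp_subtype_val {g : E → M} (ζ : FormField E' M) {x : Ω}
    (hg : MDifferentiableAt 𝓘(ℂ, E) 𝓘(ℂ, E') g x) :
    pullback (E := E) (fun y : Ω => g y) ζ x =
      pullForm (differential (E := E) g x) (ζ (g x)) := by
  let A : E →L[ℂ] E' := differential (E := E) g x
  have h : HasMFDerivAt 𝓘(ℂ, E) 𝓘(ℂ, E') (fun y : Ω => g y) x
      (A.comp (ContinuousLinearMap.id ℂ E)) :=
    HasMFDerivAt.comp x hg.hasMFDerivAt (hasMFDerivAt_subtype_val x)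
  have h' : differential (E := E) (fun y : Ω => g y) x = A := h.mfderiv
  unfold pullback
  rw [h']

end OpenSubsets

section Quotients

variable {E : Type*} [NormedAddCommGroup E] [NormedSpace ℂ E]
  {Γ : Type*} [Group Γ] {Ω : Opens E} [MulAction Γ Ω] [LinearCoveringAction Γ Ω]

lemma contMDiff_proj : ContMDiff 𝓘(ℂ, E) 𝓘(ℂ, E) (ω : WithTop ℕ∞) (proj Γ Ω) := by
  intro x
  have hx := mem_chart_source E (proj Γ Ω x)
  obtain ⟨g, L, -, hL⟩ := quotChart_proj (proj Γ Ω x) hx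
  have h1 : ContMDiffAt 𝓘(ℂ, E) 𝓘(ℂ, E) ω (fun y : Ω => L (y : E)) x :=
    L.contDiff.contMDiff.contMDiffAt.comp x contMDiff_subtype_val.contMDiffAt
  have h2 : ContMDiffAt 𝓘(ℂ, E) 𝓘(ℂ, E) ω
      (fun y => chartAt E (proj Γ Ω x) (proj Γ Ω y)) x := h1.congr_of_eventuallyEq hL
  have h3 : ContMDiffAt 𝓘(ℂ, E) 𝓘(ℂ, E) ω (chartAt E (proj Γ Ω x)).symm
      (chartAt E (proj Γ Ω x) (proj Γ Ω x)) :=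
    (contMDiffOn_chart_symm (I := 𝓘(ℂ, E)) (n := ω) (x := proj Γ Ω x)).contMDiffAt
      ((chartAt E (proj Γ Ω x)).open_target.mem_nhds ((chartAt E (proj Γ Ω x)).map_source hx))
  refine (h3.comp x h2).congr_of_eventuallyEq ?_
  filter_upwards [(isQuotientCoveringMap_proj Γ Ω).continuous.continuousAt
    ((chartAt E (proj Γ Ω x)).open_source.mem_nhds hx)] with y hy
  exact ((chartAt E (proj Γ Ω x)).left_inv hy).symm

lemma proj_quotChart (p : OrbitSpace Γ Ω) {q : OrbitSpace Γ Ω} (hq : q ∈ (quotChart p).source) :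
    ∃ h : quotChart p q ∈ Ω, proj Γ Ω ⟨quotChart p q, h⟩ = q := by
  have hq' : q ∈ (sheet p).target := by simpa [quotChart] using hq
  refine ⟨((sheet p).symm q).2, ?_⟩
  have := (sheet p).right_inv hq'
  rw [coe_sheet] at this
  exact this

end Quotients

/-! ### Local lifts from Hopf manifolds and from the surface -/

section Lift

variable {E : Type*} [NormedAddCommGroup E] [InnerProductSpace ℂ E]

lemma pullForm_comp {E₁ E₂ E₃ : Type*} [NormedAddCommGroup E₁] [NormedSpace ℂ E₁]
    [NormedAddCommGroup E₂] [NormedSpace ℂ E₂] [NormedAddCommGroup E₃] [NormedSpace ℂ E₃]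
    (A : E₂ →L[ℂ] E₃) (B : E₁ →L[ℂ] E₂) (η : LinearMap.BilinForm ℝ E₃) :
    pullForm (A.comp B) η = pullForm B (pullForm A η) := rfl

/-- A holomorphic map from an open set into a Hopf manifold lifts locally to `E`. -/
lemma exists_local_lift {V : Type*} [NormedAddCommGroup V] [NormedSpace ℂ V] {Ω : Opens V}
    {l : HopfFactor} {F : Ω → Hopf E l} {η : FormField V V}
    (hF : IsHolomorphicIsometry (restrict Ω η) (hopfForm E l) F) (x : Ω) :
    ∃ (U : Set V) (hU : U ⊆ Ω) (f : V → E), IsOpen U ∧ Convex ℝ U ∧ (x : V) ∈ U ∧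
      ∀ (z : V) (hz : z ∈ U), ContDiffAt ℂ ω f z ∧
        (∃ h : f z ∈ punctured E, proj _ _ ⟨f z, h⟩ = F ⟨z, hU hz⟩) ∧
        pullForm (fderiv ℂ f z) ((‖f z‖ ^ 2)⁻¹ • flatForm E (f z)) = η z := by
  -- `G` and `P` extend `F` and the projection to whole vector spaces; the default value `F x` is
  -- harmless, since derivatives are taken only at points of the open domains.
  set G : V → Hopf E l := Function.extend Subtype.val F fun _ => F x with hG
  set P : E → Hopf E l :=
    Function.extend Subtype.val (proj (Subgroup.zpowers l.val) (punctured E)) fun _ => F x with hP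
  have hGF : ∀ y : Ω, G y = F y := fun y => Subtype.val_injective.extend_apply _ _ y
  have hPp : ∀ y : punctured E, P y = proj _ _ y := fun y =>
    Subtype.val_injective.extend_apply _ _ y
  have hGF' : (fun y : Ω => G y) = F := funext hGF
  have hPp' : (fun y : punctured E => P y) = proj _ _ := funext hPp
  have hGs : ∀ z ∈ Ω, ContMDiffAt 𝓘(ℂ, V) 𝓘(ℂ, E) ω G z := fun z hz =>
    (contMDiffAt_subtype_iff (x := (⟨z, hz⟩ : Ω))).1 (by rw [hGF']; exact hF.holomorphic _)
  have hPs : ∀ z ∈ punctured E, ContMDiffAt 𝓘(ℂ, E) 𝓘(ℂ, E) ω P z := fun z hz =>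
    (contMDiffAt_subtype_iff (x := (⟨z, hz⟩ : punctured E))).1
      (by rw [hPp']; exact contMDiff_proj _)
  have hnear : ∀ᶠ z in 𝓝 (x : V), z ∈ Ω ∧ G z ∈ (quotChart (F x)).source := by
    have h : (quotChart (F x)).source ∈ 𝓝 (G x) := by
      rw [hGF]
      exact (quotChart (F x)).open_source.mem_nhds (mem_chart_source E (F x))
    filter_upwards [Ω.isOpen.mem_nhds x.2, (hGs x x.2).continuousAt h] with z h1 h2
    exact ⟨h1, h2⟩
  -- A ball, because polarization needs a convex set. The lift is the chart at `F x`, a local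
  -- section of the projection, composed with `G`.
  obtain ⟨ε, hε, hball⟩ := Metric.eventually_nhds_iff_ball.1 hnear
  refine ⟨Metric.ball x ε, fun z hz => (hball z hz).1, fun z => quotChart (F x) (G z),
    Metric.isOpen_ball, convex_ball _ _, Metric.mem_ball_self hε, fun z hz => ?_⟩
  have hsm : ContDiffAt ℂ ω (fun z => quotChart (F x) (G z)) z := by
    rw [← contMDiffAt_iff_contDiffAt]
    exact ((contMDiffOn_chart (I := 𝓘(ℂ, E)) (n := ω) (x := F x)).contMDiffAt
      ((quotChart (F x)).open_source.mem_nhds (hball z hz).2)).comp z (hGs z (hball z hz).1)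
  have hproj : ∀ y ∈ Metric.ball (x : V) ε, ∃ h : quotChart (F x) (G y) ∈ punctured E,
      proj (Subgroup.zpowers l.val) _ ⟨_, h⟩ = G y :=
    fun y hy => proj_quotChart (F x) (hball y hy).2
  refine ⟨hsm, ?_, ?_⟩
  · obtain ⟨h, h'⟩ := hproj z hz
    exact ⟨h, h'.trans (hGF ⟨z, (hball z hz).1⟩)⟩
  · obtain ⟨h, h'⟩ := hproj z hz
    set f : V → E := fun z => quotChart (F x) (G z) with hf
    have hPG : P (f z) = G z := (hPp ⟨_, h⟩).trans h'
    have h1 : pullForm (differential P (f z)) (hopfForm E l (P (f z))) =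
        (‖f z‖ ^ 2)⁻¹ • flatForm E (f z) := by
      rw [← pullback_comp_subtype_val (x := (⟨f z, h⟩ : punctured E)) (hopfForm E l)
        ((hPs _ h).mdifferentiableAt (by simp)), hPp', pullback_hopfForm, restrict_apply]
    have h2 : pullForm (differential G z) (hopfForm E l (G z)) = η z := by
      rw [← pullback_comp_subtype_val (x := (⟨z, (hball z hz).1⟩ : Ω)) (hopfForm E l)
        ((hGs _ (hball z hz).1).mdifferentiableAt (by simp)), hGF', hF.pullback_eq, restrict_apply]
    let A : E →L[ℂ] E := differential P (f z)
    have h3 : HasMFDerivAt 𝓘(ℂ, V) 𝓘(ℂ, E) (P ∘ f) z (A.comp (fderiv ℂ f z)) :=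
      HasMFDerivAt.comp z ((hPs _ h).mdifferentiableAt (by simp)).hasMFDerivAt
        (hsm.differentiableAt (by simp)).hasFDerivAt.hasMFDerivAt
    have h4 : G =ᶠ[𝓝 z] P ∘ f := by
      filter_upwards [Metric.isOpen_ball.mem_nhds hz] with y hy
      obtain ⟨k, k'⟩ := hproj y hy
      exact (((hPp ⟨_, k⟩).trans k')).symm
    have h5 : differential G z = A.comp (fderiv ℂ f z) :=
      (h3.congr_of_eventuallyEq h4).mfderiv
    rw [← h2, h5, pullForm_comp, ← hPG, h1]

end Lift

section Surface

variable (Γ : Subgroup G) [DiscreteTopology Γ] [ProperSMul Γ D] [IsCancelSMul Γ D]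
  {E : Type*} [NormedAddCommGroup E] [InnerProductSpace ℂ E]

lemma isHolomorphicIsometry_comp_proj {l : HopfFactor} {f : Surface Γ → Hopf E l}
    (hf : IsHolomorphicIsometry (belgunForm Γ) (hopfForm E l) f) :
    IsHolomorphicIsometry (restrict D fun z => imProd z • kahlerForm z) (hopfForm E l)
      (f ∘ proj Γ D) where
  holomorphic := hf.holomorphic.comp contMDiff_proj
  pullback_eq := by
    rw [← pullback_belgunForm Γ, ← hf.pullback_eq]
    funext x
    let A : (Fin 2 → ℂ) →L[ℂ] E := differential f (proj Γ D x)
    let B : (Fin 2 → ℂ) →L[ℂ] (Fin 2 → ℂ) := differential (proj Γ D) x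
    have h' : HasMFDerivAt 𝓘(ℂ, Fin 2 → ℂ) 𝓘(ℂ, E) (f ∘ proj Γ D) x (A.comp B) :=
      HasMFDerivAt.comp x ((hf.holomorphic _).mdifferentiableAt (by simp)).hasMFDerivAt
        (mdifferentiable_proj x).hasMFDerivAt
    have h : differential (f ∘ proj Γ D) x = A.comp B := h'.mfderiv
    unfold pullback
    rw [h]
    rfl

end Surface

/-! ### Connectedness of `D` and lines moved by a cocompact group -/

section Domain

/-- `D` is the image of the upper half-plane times ℂ^* under (w, t) ↦ (wt, t). -/
lemma isPreconnected_D : IsPreconnected (D : Set (Fin 2 → ℂ)) := by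
  have h1 : IsPreconnected ({w : ℂ | 0 < w.im} ×ˢ ({0}ᶜ : Set ℂ)) :=
    (convex_halfSpace_im_gt 0).isPreconnected.prod
      (isConnected_compl_singleton_of_one_lt_rank (by simp) 0).isPreconnected
  have h2 : (D : Set (Fin 2 → ℂ)) =
      (fun a : ℂ × ℂ => ![a.1 * a.2, a.2]) '' ({w : ℂ | 0 < w.im} ×ˢ ({0}ᶜ : Set ℂ)) := by
    have e : ∀ w t : ℂ, imProd ![w * t, t] = w.im * Complex.normSq t := by
      intro w t
      simp [imProd, Complex.normSq_apply]
      ring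
    ext z
    constructor
    · intro hz
      have hz' : 0 < imProd z := hz
      have hz1 : z 1 ≠ 0 := fun h => by simp [imProd, h] at hz'
      have hz2 : ![z 0 / z 1 * z 1, z 1] = z := by
        ext i
        fin_cases i <;> simp [hz1]
      refine ⟨(z 0 / z 1, z 1), ⟨?_, hz1⟩, hz2⟩
      rw [← hz2, e] at hz'
      exact pos_of_mul_pos_left hz' (Complex.normSq_nonneg _)
    · rintro ⟨⟨w, t⟩, ⟨hw, ht⟩, rfl⟩
      change 0 < imProd _
      rw [e]
      exact mul_pos hw (Complex.normSq_pos.2 ht)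
  rw [h2]
  refine h1.image _ (Continuous.continuousOn ?_)
  fun_prop

lemma apply_one_ne_zero (z : D) : (z : Fin 2 → ℂ) 1 ≠ 0 := fun h => by
  have hz : 0 < imProd z := z.2
  simp [imProd, h] at hz

/-- A group with compact quotient `D / Γ` moves some line of `ℂ²`. -/
lemma exists_line_moved (Γ : Subgroup G) [CompactSpace (Surface Γ)] :
    ∃ (γ : Γ) (z : D), z.1 0 * (γ • z : D).1 1 ≠ z.1 1 * (γ • z : D).1 0 := by
  by_contra! h
  -- If all lines are preserved, x / y is Γ-invariant. Its imaginary part takes every positive value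
  -- on `D`, against compactness.
  let height : Surface Γ → ℝ := Quotient.lift (fun z : D => (z.1 0 / z.1 1).im) (by
    rintro _ z ⟨γ, rfl⟩
    have h1 := apply_one_ne_zero z
    have h2 := apply_one_ne_zero (γ • z)
    have : (γ • z : D).1 0 / (γ • z : D).1 1 = z.1 0 / z.1 1 := by
      rw [div_eq_div_iff h2 h1, mul_comm, ← h γ z]
    exact congrArg Complex.im this)
  have hc : Continuous height := by
    refine Continuous.quotient_lift ?_ _
    exact Complex.continuous_im.comp (((continuous_apply 0).comp continuous_subtype_val).div
      ((continuous_apply 1).comp continuous_subtype_val) apply_one_ne_zero)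
  obtain ⟨b, hb⟩ := (isCompact_range hc).bddAbove
  have hmem : ![(((|b| + 1 : ℝ) : ℂ)) * Complex.I, 1] ∈ D := by
    change 0 < imProd _
    simp [imProd]
    positivity
  have := hb ⟨proj Γ D ⟨_, hmem⟩, rfl⟩
  have h2 : height (proj Γ D ⟨_, hmem⟩) = |b| + 1 := by
    change (_ : ℂ).im = _
    simp
  rw [h2] at this
  linarith [le_abs_self b]

end Domain

/-! ### From two-forms to Hermitian identities -/

section Hermitian

variable {E : Type*} [NormedAddCommGroup E] [InnerProductSpace ℂ E]

/-- Both sides are complex linear in w, so the real part at w is the imaginary part at iw. -/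
lemma inner_eq_of_im_eq {L : (Fin 2 → ℂ) →L[ℂ] E} {p : Fin 2 → ℂ} {c : ℝ}
    (h : ∀ v w, (inner ℂ (L v) (L w)).im = c * (hess p p v w).im) (v w : Fin 2 → ℂ) :
    inner ℂ (L v) (L w) = c * hess p p v w := by
  apply Complex.ext
  · have h1 := h v (Complex.I • w)
    have h2 : hess p p v (Complex.I • w) = Complex.I * hess p p v w := by
      simp [hess, wedge]; ring
    rw [map_smul, inner_smul_right, h2] at h1
    simpa using h1
  · simpa using h v w

lemma inner_fderiv_of_conformal {f : (Fin 2 → ℂ) → E} {z : Fin 2 → ℂ} (hz : z ∈ D)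
    (hf : f z ≠ 0) (h : pullForm (fderiv ℂ f z) ((‖f z‖ ^ 2)⁻¹ • flatForm E (f z)) =
      imProd z • kahlerForm z) (v w : Fin 2 → ℂ) :
    inner ℂ (fderiv ℂ f z v) (fderiv ℂ f z w) * wedge z z ^ 2 =
      inner ℂ (f z) (f z) * hess z z v w := by
  have hr : imProd z ≠ 0 := ne_of_gt hz
  have hn : ‖f z‖ ≠ 0 := norm_ne_zero_iff.2 hf
  rw [inner_eq_of_im_eq (c := -‖f z‖ ^ 2 / (4 * imProd z ^ 2)) (fun v w => ?_), wedge_self,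
    inner_self_eq_norm_sq_to_K]
  · have : (imProd z : ℂ) ≠ 0 := Complex.ofReal_ne_zero.2 hr
    push_cast
    field_simp
    rw [Complex.I_sq]
    simp
    ring
  · have h1 : (‖f z‖ ^ 2)⁻¹ * (inner ℂ (fderiv ℂ f z v) (fderiv ℂ f z w)).im =
        imProd z * kahlerForm z v w :=
      congrArg (fun B : LinearMap.BilinForm ℝ (Fin 2 → ℂ) => B v w) h
    rw [kahlerForm_apply hz, inv_mul_eq_iff_eq_mul₀ (pow_ne_zero 2 hn)] at h1
    rw [h1]
    field_simp

lemma inner_fderiv_of_isometric {f : (Fin 2 → ℂ) → E} {z : Fin 2 → ℂ} (hz : z ∈ D)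
    (h : pullForm (fderiv ℂ f z) (flatForm E (f z)) = kahlerForm z) (v w : Fin 2 → ℂ) :
    inner ℂ (fderiv ℂ f z v) (fderiv ℂ f z w) * wedge z z ^ 3 =
      2 * Complex.I * hess z z v w := by
  have hr : imProd z ≠ 0 := ne_of_gt hz
  rw [inner_eq_of_im_eq (c := -1 / (4 * imProd z ^ 3)) (fun v w => ?_), wedge_self]
  · have : (imProd z : ℂ) ≠ 0 := Complex.ofReal_ne_zero.2 hr
    push_cast
    field_simp
    rw [Complex.I_sq]
    ring
  · have h1 : (inner ℂ (fderiv ℂ f z v) (fderiv ℂ f z w)).im = kahlerForm z v w :=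
      congrArg (fun B : LinearMap.BilinForm ℝ (Fin 2 → ℂ) => B v w) h
    rw [h1, kahlerForm_apply hz]
    field_simp

end Hermitian

/-! ### Maps to Hopf manifolds separate lines -/

section HopfMaps

variable {E : Type*} [NormedAddCommGroup E] [InnerProductSpace ℂ E] {l : HopfFactor}

lemma exists_out_eq_smul (y : punctured E) :
    ∃ c : ℂ, c ≠ 0 ∧ ((proj (Subgroup.zpowers l.val) (punctured E) y).out : E) = c • (y : E) := by
  obtain ⟨g, hg⟩ := proj_eq_iff.1 (proj_out (proj (Subgroup.zpowers l.val) (punctured E) y))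
  exact ⟨((g : ℂˣ) : ℂ), (g : ℂˣ).ne_zero, by rw [← hg]; rfl⟩

lemma norm_inner_sq_div_smul (u y : E) {c : ℂ} (hc : c ≠ 0) :
    ‖(inner ℂ u (c • y) : ℂ)‖ ^ 2 / ‖c • y‖ ^ 2 = ‖(inner ℂ u y : ℂ)‖ ^ 2 / ‖y‖ ^ 2 := by
  have hc' : ‖c‖ ≠ 0 := norm_ne_zero_iff.2 hc
  rw [inner_smul_right, norm_mul, norm_smul, mul_pow, mul_pow, mul_div_mul_left _ _
    (pow_ne_zero 2 hc')]

lemma contDiff_real_wedge (p : Fin 2 → ℂ) : ContDiff ℝ ω fun z => ‖wedge z p‖ ^ 2 :=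
  ((contDiff_wedge p (n := ω)).restrict_scalars ℝ).norm_sq ℝ

lemma contDiff_imProd : ContDiff ℝ ω imProd := by
  have h : imProd = fun z => (1 / 2 : ℝ) * wedgeIm z z := by
    funext z
    simp [wedgeIm_apply, wedge_self]
  rw [h]
  exact contDiff_const.mul (wedgeIm.contDiff.clm_apply contDiff_id)

/-- A conformal map to a Hopf manifold determines the angles between the lines of the image. -/
lemma norm_inner_out {F : D → Hopf E l}
    (hF : IsHolomorphicIsometry (restrict D fun z => imProd z • kahlerForm z) (hopfForm E l) F)
    (p q : D) :
    ‖(inner ℂ ((F p).out : E) ((F q).out : E) : ℂ)‖ ^ 2 / ‖((F q).out : E)‖ ^ 2 *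
      ‖wedge q p‖ ^ 2 = 4 * imProd p * ‖((F p).out : E)‖ ^ 2 * imProd q := by
  set u : E := (F p).out.1 with hu
  -- The chosen representatives `o z` need not depend continuously on z; only quantities invariant
  -- under scaling of `o z` are used, and these agree with those of the local lifts.
  set o : (Fin 2 → ℂ) → E := Function.extend Subtype.val (fun z : D => ((F z).out : E)) 0 with ho
  have ho' : ∀ z : D, o z = (F z).out := fun z => Subtype.val_injective.extend_apply _ _ z
  have hlift := exists_local_lift hF
  have hratio : ∀ (z : D) (y : E) (h : y ∈ punctured E), proj _ _ ⟨y, h⟩ = F z →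
      ‖(inner ℂ u (o z) : ℂ)‖ ^ 2 / ‖o z‖ ^ 2 = ‖(inner ℂ u y : ℂ)‖ ^ 2 / ‖y‖ ^ 2 := by
    intro z y h hy
    obtain ⟨c, hc, hcy⟩ := exists_out_eq_smul (l := l) ⟨y, h⟩
    rw [ho', ← hy, hcy]
    exact norm_inner_sq_div_smul u y hc
  have hA : AnalyticOnNhd ℝ
      (fun z => ‖(inner ℂ u (o z) : ℂ)‖ ^ 2 / ‖o z‖ ^ 2 * ‖wedge z p‖ ^ 2) D := by
    intro z hz
    obtain ⟨U, hUD, f, hUo, -, hzU, hf⟩ := hlift ⟨z, hz⟩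
    have hfz : ContDiffAt ℝ ω f z := (hf z hzU).1.restrict_scalars ℝ
    obtain ⟨h0, -⟩ := (hf z hzU).2.1
    have hn : ‖f z‖ ^ 2 ≠ 0 := pow_ne_zero 2 (norm_ne_zero_iff.2 h0)
    have h1 : ContDiffAt ℝ ω
        (fun z => ‖(inner ℂ u (f z) : ℂ)‖ ^ 2 / ‖f z‖ ^ 2 * ‖wedge z p‖ ^ 2) z :=
      (((contDiffAt_const.inner ℂ hfz).norm_sq ℝ).div (hfz.norm_sq ℂ) hn).mul
        (contDiff_real_wedge p).contDiffAt
    refine (h1.congr_of_eventuallyEq ?_).analyticAt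
    filter_upwards [hUo.mem_nhds hzU] with x hx
    obtain ⟨h, h'⟩ := (hf x hx).2.1
    rw [hratio ⟨x, hUD hx⟩ _ h h']
  have hB : AnalyticOnNhd ℝ (fun z => 4 * imProd p * ‖u‖ ^ 2 * imProd z) D := fun z _ =>
    (contDiff_const.mul contDiff_imProd).contDiffAt.analyticAt
  have hnear : (fun z => ‖(inner ℂ u (o z) : ℂ)‖ ^ 2 / ‖o z‖ ^ 2 * ‖wedge z p‖ ^ 2)
      =ᶠ[𝓝 p.1] fun z => 4 * imProd p * ‖u‖ ^ 2 * imProd z := by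
    obtain ⟨U, hUD, f, hUo, hUc, hpU, hf⟩ := hlift p
    filter_upwards [hUo.mem_nhds hpU] with z hz
    obtain ⟨h, h'⟩ := (hf z hz).2.1
    obtain ⟨k, k'⟩ := (hf p hpU).2.1
    obtain ⟨c, hc, hcy⟩ := exists_out_eq_smul (l := l) ⟨_, k⟩
    have hu' : u = c • f p := by rw [hu, ← hcy, k']
    have hloc := conformal_norm_inner hUc hUo hUD (fun x hx => (hf x hx).1)
      (fun x hx => inner_fderiv_of_conformal (hUD hx) (hf x hx).2.1.1 (hf x hx).2.2) hpU hz
    have hn : ‖f z‖ ≠ 0 := norm_ne_zero_iff.2 h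
    rw [hratio ⟨z, hUD hz⟩ _ h h', hu', inner_smul_left, norm_mul, norm_smul, Complex.norm_conj]
    field_simp
    linear_combination hloc
  have := hA.eqOn_of_preconnected_of_eventuallyEq hB isPreconnected_D p.2 hnear q.2
  simpa only [ho'] using this

/-- For equal images the angle vanishes, so |`wedge q p`|² = 4 `imProd p` `imProd q`, and
`norm_wedge_sq` makes the determinant of (p, q) zero. -/
lemma mul_eq_mul_of_apply_eq {F : D → Hopf E l}
    (hF : IsHolomorphicIsometry (restrict D fun z => imProd z • kahlerForm z) (hopfForm E l) F)
    {p q : D} (h : F p = F q) : (q : Fin 2 → ℂ) 0 * p.1 1 = (q : Fin 2 → ℂ) 1 * p.1 0 := by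
  have h1 := norm_inner_out hF p q
  have hn : ‖((F q).out : E)‖ ≠ 0 := norm_ne_zero_iff.2 (F q).out.2
  rw [h, inner_self_eq_norm_sq_to_K, norm_wedge_sq] at h1
  simp only [norm_pow, Complex.coe_algebraMap, Complex.norm_real, norm_norm] at h1
  field_simp at h1
  have h2 : ‖(q : Fin 2 → ℂ) 0 * p.1 1 - (q : Fin 2 → ℂ) 1 * p.1 0‖ ^ 2 = 0 := by linarith
  exact sub_eq_zero.1 (norm_eq_zero.1 (pow_eq_zero_iff two_ne_zero |>.1 h2))

lemma not_exists_isHolomorphicIsometry_hopf (Γ : Subgroup G) [DiscreteTopology Γ] [ProperSMul Γ D]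
    [IsCancelSMul Γ D] [CompactSpace (Surface Γ)] :
    ¬ ∃ f : Surface Γ → Hopf E l, IsHolomorphicIsometry (belgunForm Γ) (hopfForm E l) f := by
  rintro ⟨f, hf⟩
  obtain ⟨γ, z, h⟩ := exists_line_moved Γ
  refine h (mul_eq_mul_of_apply_eq (isHolomorphicIsometry_comp_proj Γ hf) (p := γ • z) ?_)
  exact congrArg f (proj_eq_iff.2 ⟨γ, rfl⟩)

end HopfMaps

/-! ### Radial derivatives and equivariant Kähler immersions -/

section Equivariance

variable {E : Type*} [NormedAddCommGroup E] [InnerProductSpace ℂ E] {f : (Fin 2 → ℂ) → E}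

/-- In the directions q and p the numerator `hess p q q p` is `wedge p q` ², so the polarized metric
2i `hess` / `wedge` ³ collapses to the kernel 2i / `wedge` itself. -/
lemma inner_fderiv_radial (hf : ∀ z ∈ D, ContDiffAt ℂ ω f z)
    (h : ∀ z ∈ D, pullForm (fderiv ℂ f z) (flatForm E (f z)) = kahlerForm z)
    {p q : Fin 2 → ℂ} (hp : p ∈ D) (hq : q ∈ D) :
    inner ℂ (fderiv ℂ f q q) (fderiv ℂ f p p) * wedge p q = 2 * Complex.I := by
  have hglob : ∀ w, inner ℂ (fderiv ℂ f q q) (fderiv ℂ f p w) * wedge p q ^ 3 =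
      2 * Complex.I * hess p q q w := by
    intro w
    have hA : AnalyticOnNhd ℂ
        (fun p => inner ℂ (fderiv ℂ f q q) (fderiv ℂ f p w) * wedge p q ^ 3) D := by
      intro z hz
      have h1 : ContDiffAt ℂ ω (fun p => fderiv ℂ f p w) z :=
        ((hf z hz).fderiv_right (m := ω) le_top).clm_apply contDiffAt_const
      have h2 : ContDiffAt ℂ ω (fun p => innerSL ℂ (fderiv ℂ f q q) (fderiv ℂ f p w)) z :=
        (innerSL ℂ (fderiv ℂ f q q)).contDiff.contDiffAt.comp z h1
      exact (h2.mul ((contDiff_wedge q).contDiffAt.pow 3)).analyticAt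
    have hB : AnalyticOnNhd ℂ (fun p => 2 * Complex.I * hess p q q w) D := by
      intro z _
      have h1 := (contDiff_wedge q (n := ω)).contDiffAt (x := z)
      unfold hess
      exact (contDiffAt_const.mul ((contDiffAt_const.mul h1).sub
        (contDiffAt_const.mul h1))).analyticAt
    -- Polarization gives the identity on a ball around q; both sides are holomorphic in p on the
    -- connected set `D`.
    refine hA.eqOn_of_preconnected_of_eventuallyEq hB isPreconnected_D hq ?_ hp
    obtain ⟨ε, hε, hball⟩ := Metric.mem_nhds_iff.1 (D.isOpen.mem_nhds hq)
    filter_upwards [Metric.ball_mem_nhds q hε] with x hx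
    exact isometric_polarized (convex_ball q ε) Metric.isOpen_ball (fun z hz => hf z (hball hz))
      (fun z hz => inner_fderiv_of_isometric (hball hz) (h z (hball hz))) hx
      (Metric.mem_ball_self hε) q w
  have h0 := wedge_ne_zero hp hq
  have h1 := hglob p
  have h2 : hess p q q p = wedge p q ^ 2 := by unfold hess; ring
  rw [h2] at h1
  refine mul_right_cancel₀ (pow_ne_zero 2 h0) ?_
  linear_combination h1

lemma eq_zero_of_wedge_eq_zero {x : Fin 2 → ℂ} (h : ∀ q ∈ D, wedge x q = 0) : x = 0 := by
  have e1 := h ![Complex.I, 1] (by change 0 < imProd _; simp [imProd])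
  have e2 := h ![2 * Complex.I, 1] (by change 0 < imProd _; simp [imProd])
  have e3 : conj (2 : ℂ) = 2 := map_ofNat _ 2
  simp [wedge, e3] at e1 e2
  have h1 : x 1 = 0 := by
    have : x 1 * Complex.I = 0 := by linear_combination e2 - e1
    simpa using this
  have h0 : x 0 = 0 := by simpa [h1] using e1
  ext i
  fin_cases i
  · exact h0
  · exact h1

/-- A Kähler immersion of `D` into a Hilbert space that is equivariant for a linear
automorphism `L` of `D` and a scalar `χ` exists only if `χ L = id`. -/
lemma smul_eq_of_equivariant (hf : ∀ z ∈ D, ContDiffAt ℂ ω f z)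
    (h : ∀ z ∈ D, pullForm (fderiv ℂ f z) (flatForm E (f z)) = kahlerForm z)
    {L : (Fin 2 → ℂ) →L[ℂ] (Fin 2 → ℂ)} (hL : ∀ z ∈ D, L z ∈ D) {χ : ℂ}
    (hχ : ∀ z ∈ D, f (L z) = χ • f z) {z : Fin 2 → ℂ} (hz : z ∈ D) : χ • L z = z := by
  have hd : ∀ w, fderiv ℂ f (L z) (L w) = χ • fderiv ℂ f z w := by
    intro w
    have h1 : HasFDerivAt (fun z => f (L z)) ((fderiv ℂ f (L z)).comp L) z :=
      ((hf _ (hL z hz)).differentiableAt (by simp)).hasFDerivAt.comp z L.hasFDerivAt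
    have h2 : HasFDerivAt (fun z => f (L z)) (χ • fderiv ℂ f z) z :=
      (((hf z hz).differentiableAt (by simp)).hasFDerivAt.const_smul χ).congr_of_eventuallyEq
        (Filter.eventually_of_mem (D.isOpen.mem_nhds hz) hχ)
    exact congrArg (fun A : (Fin 2 → ℂ) →L[ℂ] E => A w) (h1.unique h2)
  refine sub_eq_zero.1 (eq_zero_of_wedge_eq_zero fun q hq => ?_)
  -- The radial derivative at `L z` is χ times that at z; comparing the kernels gives χ · `wedge (L
  -- z) q` = `wedge z q` for all q in `D`.
  have h1 := inner_fderiv_radial hf h (hL z hz) hq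
  have h2 := inner_fderiv_radial hf h hz hq
  rw [hd, inner_smul_right] at h1
  have h3 : (inner ℂ (fderiv ℂ f q q) (fderiv ℂ f z z) : ℂ) ≠ 0 := fun h0 => by
    simp [h0] at h2
  have h4 : wedge (χ • L z - z) q = χ * wedge (L z) q - wedge z q := by
    simp [wedge]; ring
  rw [h4]
  refine mul_left_cancel₀ h3 ?_
  linear_combination h1 - h2

lemma smul_coe_eq_of_equivariant {Γ : Subgroup G} {ψ : D → E}
    (hψ : IsHolomorphicIsometry (restrict D kahlerForm) (flatForm E) ψ) {γ : Γ} {χ : ℂ}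
    (h : ∀ z : D, ψ (γ • z) = χ • ψ z) (z : D) : χ • ((γ • z : D) : Fin 2 → ℂ) = z := by
  set f : (Fin 2 → ℂ) → E := Function.extend Subtype.val ψ 0 with hf
  have hfψ : ∀ z : D, f z = ψ z := fun z => Subtype.val_injective.extend_apply _ _ z
  have hfψ' : (fun z : D => f z) = ψ := funext hfψ
  have hfs : ∀ z ∈ D, ContMDiffAt 𝓘(ℂ, Fin 2 → ℂ) 𝓘(ℂ, E) ω f z := fun z hz =>
    (contMDiffAt_subtype_iff (x := (⟨z, hz⟩ : D))).1 (by rw [hfψ']; exact hψ.holomorphic _)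
  refine smul_eq_of_equivariant (f := f)
    (L := (Matrix.mulVecLin (γ : G).1.val).toContinuousLinearMap)
    (fun z hz => contMDiffAt_iff_contDiffAt.1 (hfs z hz)) (fun z hz => ?_)
    (fun z hz => (γ • (⟨z, hz⟩ : D)).2) (fun z hz => ?_) z.2
  · have h1 := pullback_comp_subtype_val (x := (⟨z, hz⟩ : D)) (flatForm E)
      ((hfs z hz).mdifferentiableAt (by simp))
    rw [hfψ', hψ.pullback_eq, restrict_apply] at h1
    have h2 : differential f z = fderiv ℂ f z := mfderiv_eq_fderiv
    rw [← h2, ← h1]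
  · have := h ⟨z, hz⟩
    rw [← hfψ, ← hfψ] at this
    exact this

end Equivariance

end LcK

open LcK in
theorem mainTheorem9 (Γ : Subgroup LcK.G) [DiscreteTopology Γ] [ProperSMul Γ LcK.D]
    [IsCancelSMul Γ LcK.D] [CompactSpace (LcK.Surface Γ)] :
    (∀ (l : HopfFactor) (N : ℕ), ¬ ∃ f : Surface Γ → Hopf (EuclideanSpace ℂ (Fin N)) l,
      IsHolomorphicIsometry (belgunForm Γ) (hopfForm (EuclideanSpace ℂ (Fin N)) l) f) ∧
    (∀ l : HopfFactor, ¬ ∃ f : Surface Γ → Hopf EllTwo l,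
      IsHolomorphicIsometry (belgunForm Γ) (hopfForm EllTwo l) f) ∧
    (∀ ψ : D → EllTwo, IsHolomorphicIsometry (restrict D kahlerForm) (flatForm EllTwo) ψ →
      (¬ ∃ χ : Γ → ℂ, ∀ (γ : Γ) (z : D), ψ (γ • z) = χ γ • ψ z) ∧
      (∀ γ : Γ, γ ≠ 1 →
        (∃ c : ℂˣ, ((γ : G) : GL (Fin 2) ℂ) = Matrix.GeneralLinearGroup.scalar (Fin 2) c) →
        ∃ z : D, ψ (γ • z) ≠ ψ z)) := by
  refine ⟨fun l N => not_exists_isHolomorphicIsometry_hopf Γ,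
    fun l => not_exists_isHolomorphicIsometry_hopf Γ, fun ψ hψ => ⟨?_, ?_⟩⟩
  · rintro ⟨χ, hχ⟩
    obtain ⟨γ, z, h⟩ := exists_line_moved Γ
    have h1 := smul_coe_eq_of_equivariant hψ (hχ γ) z
    have h2 : ∀ i, χ γ * (γ • z : D).1 i = z.1 i := fun i => congrFun h1 i
    apply h
    rw [← h2 0, ← h2 1]
    ring
  · rintro γ hγ -
    by_contra! h
    -- Only a point of `D` is needed here: γ fixes it, and the action is free.
    obtain ⟨-, z, -⟩ := exists_line_moved Γ
    have h1 := smul_coe_eq_of_equivariant hψ (χ := 1) (γ := γ) (fun z => by rw [h z, one_smul]) z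
    rw [one_smul] at h1
    refine hγ (IsCancelSMul.right_cancel γ 1 z ?_)
    rw [one_smul]
    exact Subtype.ext h1
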